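/- Let $n\ge 0$ and let $\Phi$ be the root system of type $\mathbb{A}_n$ with simple roots $\alpha_1,\dots,\alpha_n$, positive roots $\alpha_i+\alpha_{i+1}+\cdots+\alpha_j$ ($1\le i\le j\le n$) and simple reflections $s_1,\dots,s_n$. Let $c=s_{\pi(1)}\cdots s_{\pi(n)}$ be any Coxeter element, $\pi$ a permutation of $\{1,\dots,n\}$. On the set $\Phi_{\ge -1}$ of almost positive roots (positive or negative simple roots), let $\sigma_k$ be the involution that fixes $-\alpha_j$ for $j\ne k$ and acts as $s_k$ otherwise, and put $\tau_c=\sigma_{\pi(1)}\circ\cdots\circ\sigma_{\pi(n)}$. Compatibility is the $\tau_c$-invariant relation on $\Phi_{\ge -1}$ such that $-\alpha_i$ is compatible with $\beta$ if and only if the coefficient of $\alpha_i$ in $\beta$ is at most $0$. The cluster complex (dual associahedron) $C$ of type $\mathbb{A}_n$ has as faces the sets of pairwise compatible almost positive roots; let $T=\{-\alpha_1,\dots,-\alpha_n\}$ be its distinguished facet. Let $F_{i,j}$ be the number of faces of $C$ with $i$ elements outside $T$ and $j$ elements in $T$, let $F(x,y)=\sum_{0\le i,j\le n}F_{i,j}x^iy^j$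 be the $F$-triangle and $$H(x,y)=(1-x)^n\,F\!\left(\frac{x}{1-x},\frac{xy}{1-x}\right)$$ the $H$-triangle. Then there is a unique family of integers $(\gamma_{i,j})_{i,j\ge0}$, the $\Gamma$-triangle of $(C,T)$, with $\gamma_{i,j}=0$ for $j+2i>n$ and $$H(x,y)=(1+x)^n\sum_{i,j}\gamma_{i,j}\left(\frac{x}{(1+x)^2}\right)^i\left(\frac{1+xy}{1+x}\right)^j .$$ For all $k,\ell\ge 0$ with $\ell+2k\le n$, the coefficient of $x^ky^\ell$ in $\Gamma(x,y)=\sum_{i,j}\gamma_{i,j}x^iy^j$ is $$\gamma_{k,\ell}=\frac{\ell+1}{n-k+1}\binom{n}{k}\binom{n-k-\ell-1}{k-1},$$ where for $k=0$ the last binomial coefficient $\binom{n-\ell-1}{-1}$ is read as $1$ if $\ell=n$ and as $0$ if $\ell<n$; that is, $\gamma_{0,n}=1$ and $\gamma_{0,\ell}=0$ for $\ell<n$. -/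

import Mathlib

noncomputable section

/-! ### Finite simplicial complexes, `F`-, `H`- and `Γ`-triangles -/

/-- A finite simplicial complex: a finite collection of finite sets closed under taking subsets
(the empty set is a face as soon as there is a face). -/
structure FinComplex (V : Type*) where
  faces : Finset (Finset V)
  down_closed : ∀ F ∈ faces, ∀ G, G ⊆ F → G ∈ faces

namespace FinComplex

variable {V : Type*} [DecidableEq V]

/-- The number `F_{i,j}` of faces made of `i` elements outside `T` and `j` elements in `T`. -/
def fNumber (C : FinComplex V) (T : Finset V) (i j : ℕ) : ℕ :=
  (C.faces.filter fun F => (F \ T).card = i ∧ (F ∩ T).card = j).card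

/-- The `F`-triangle `∑_{0 ≤ i, j ≤ d} F_{i,j} x^i y^j` of the pair `(C, T)`, where
`d = |T|`. The variables `x`, `y` are `X 0`, `X 1`. -/
def fTriangle (C : FinComplex V) (T : Finset V) : MvPolynomial (Fin 2) ℤ :=
  ∑ i ∈ Finset.range (T.card + 1), ∑ j ∈ Finset.range (T.card + 1),
    MvPolynomial.C (C.fNumber T i j : ℤ) * MvPolynomial.X 0 ^ i * MvPolynomial.X 1 ^ j

end FinComplex

/-- The field `ℚ(x, y)` of rational functions in two variables. -/
abbrev RatXY : Type := FractionRing (MvPolynomial (Fin 2) ℤ)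

/-- The variable `x` in `ℚ(x, y)`. -/
def ratX : RatXY := algebraMap (MvPolynomial (Fin 2) ℤ) RatXY (MvPolynomial.X 0)

/-- The variable `y` in `ℚ(x, y)`. -/
def ratY : RatXY := algebraMap (MvPolynomial (Fin 2) ℤ) RatXY (MvPolynomial.X 1)

namespace FinComplex

variable {V : Type*} [DecidableEq V]

/-- The `H`-triangle `H(x, y) = (1 - x)^d F(x / (1 - x), x y / (1 - x))`, with `d = |T|`. -/
def hTriangle (C : FinComplex V) (T : Finset V) : RatXY :=
  (1 - ratX) ^ T.card *
    MvPolynomial.aeval ![ratX / (1 - ratX), ratX * ratY / (1 - ratX)] (C.fTriangle T)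

/-- `γ` is the `Γ`-triangle of `(C, T)`: it is supported on the triangle `j ≤ d - 2 i`, and
`H(x, y) = (1 + x)^d ∑_{i, j} γ_{i,j} (x / (1 + x)^2)^i ((1 + x y) / (1 + x))^j`,
with `d = |T|`. -/
def IsGammaTriangle (C : FinComplex V) (T : Finset V) (γ : ℕ → ℕ → ℤ) : Prop :=
  (∀ i j, T.card < j + 2 * i → γ i j = 0) ∧
  C.hTriangle T = (1 + ratX) ^ T.card *
    ∑ i ∈ Finset.range (T.card + 1), ∑ j ∈ Finset.range (T.card + 1),
      (γ i j : RatXY) * (ratX / (1 + ratX) ^ 2) ^ i * ((1 + ratX * ratY) / (1 + ratX)) ^ j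

end FinComplex

/-! ### The cluster complex of type `A_n`

Elements of the root lattice are written in the basis of simple roots `α_0, …, α_{n-1}`, as
functions `Fin n → ℤ`. -/

namespace TypeA

variable {n : ℕ}

/-- The simple root `α_i`. -/
def simpleRoot (i : Fin n) : Fin n → ℤ := Pi.single i 1

/-- The simple reflection `s_k(v) = v - ⟨v, α_k^∨⟩ α_k`. -/
def simpleReflection (k : Fin n) (v : Fin n → ℤ) : Fin n → ℤ :=
  v - (∑ j, v j * CartanMatrix.A n j k) • simpleRoot k

/-- The negative simple roots `-α_i`. -/
def negSimpleRoots (n : ℕ) : Finset (Fin n → ℤ) :=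
  Finset.univ.image fun i : Fin n => -simpleRoot i

/-- The positive roots of type `A_n`: the sums `α_i + α_{i+1} + ⋯ + α_j` for `i ≤ j`. -/
def positiveRoots (n : ℕ) : Finset (Fin n → ℤ) :=
  ((Finset.univ : Finset (Fin n × Fin n)).filter fun p => p.1 ≤ p.2).image
    fun p => ∑ m ∈ Finset.Icc p.1 p.2, simpleRoot m

/-- The almost positive roots. -/
def almostPositiveRoots (n : ℕ) : Finset (Fin n → ℤ) :=
  negSimpleRoots n ∪ positiveRoots n

/-- The involution `σ_k` of the set of almost positive roots: it fixes `-α_j` for `j ≠ k` and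
acts as the simple reflection `s_k` on the other almost positive roots. -/
def sigma (k : Fin n) (v : Fin n → ℤ) : Fin n → ℤ :=
  if v ∈ negSimpleRoots n ∧ v ≠ -simpleRoot k then v else simpleReflection k v

/-- A Coxeter element `c = s_{π 0} s_{π 1} ⋯ s_{π (n-1)}` is given by an ordering `π` of the simple
reflections. This is the associated map `τ_c = σ_{π 0} ∘ σ_{π 1} ∘ ⋯ ∘ σ_{π (n-1)}` on almost
positive roots. -/
def tau (π : Equiv.Perm (Fin n)) : (Fin n → ℤ) → (Fin n → ℤ) :=
  (List.ofFn fun k => sigma (π k)).foldr (· ∘ ·) id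

/-- Compatibility of almost positive roots with respect to the Coxeter element `c`: it is the
`τ_c`-invariant relation for which `-α_i` is compatible with `β` if and only if the coefficient of
`α_i` in `β` is not positive (that is, `β` is a negative simple root, or a positive root whose
support does not contain `α_i`). Every almost positive root is moved to some `-α_i` by a power of
`τ_c`, so these two conditions determine the relation. -/
def Compatible (π : Equiv.Perm (Fin n)) (α β : Fin n → ℤ) : Prop :=
  ∃ (m : ℕ) (i : Fin n), (tau π)^[m] α = -simpleRoot i ∧ (tau π)^[m] β i ≤ 0

open Classical in
/-- The cluster complex of type `A_n` for the Coxeter element given by `π`: its faces are the sets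
of pairwise compatible almost positive roots. -/
def clusterComplex (π : Equiv.Perm (Fin n)) : FinComplex (Fin n → ℤ) where
  faces := (almostPositiveRoots n).powerset.filter fun F =>
    ∀ α ∈ F, ∀ β ∈ F, α ≠ β → Compatible π α β
  down_closed := by
    intro F hF G hG
    rw [Finset.mem_filter, Finset.mem_powerset] at hF ⊢
    exact ⟨hG.trans hF.1, fun α hα β hβ => hF.2 α (hG hα) β (hG hβ)⟩

end TypeA

end

/-! Send a diagonal of an (n+3)-gon to the vector of its crossing numbers with a triangulation by
nested diagonals, whose shape records for each i whether s_i precedes s_{i+1} in the word of c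
(`coxeterPath`). Each σ_k then acts as a flip of the triangulation (`sigma_crossVec`), so τ_c flips
every diagonal once, which amounts to rotating the polygon (`tau_rootOf`). Hence compatible means
noncrossing, faces are dissections, and T is the chosen triangulation (`compatible_rootOf_iff`,
`sum_faces_clusterComplex`).

The F-triangle is therefore a sum over dissections with weight v on the triangulation and u
elsewhere. Lowering the weights v to u one diagonal at a time gives a recursion that does not see
the shape of the triangulation (`triangleSum_eq`), so the sum does not depend on c. With D and T the
generating series in t of the weights (u, u) and (u, v), it reads T = D + (v-u)tDT. For a fan and v
= 0 the sum can be computed directly, whence D = (1+(1+u)tD)(1+utD) (`mk_dpoly`).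

Rescale t by (1-x)/(1+x) and put z = x/(1+x)^2, w = (1+xy)/(1+x). The series T becomes R/(1-wtR) = ∑
w^j t^j R^(j+1), where R = 1 - tR + (t+zt^2)R^2 (`triangle_eq_sum_powCoeff`). So γ_{i,j} is the
coefficient of z^i t^(n-j) in R^(j+1), which `coeff_powCoeff` evaluates by induction along the
quadratic equation. Uniqueness holds because monomials in z and w are linearly independent
(`eq_zero_of_sum_eq_zero`). -/

noncomputable section

/-! ### Dissections of convex polygons with integer vertices -/

namespace Dissection

open Finset

/-- Two chords with endpoints in `ℤ` cross. -/
def Cross (d e : ℤ × ℤ) : Prop :=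
  (d.1 < e.1 ∧ e.1 < d.2 ∧ d.2 < e.2) ∨ (e.1 < d.1 ∧ d.1 < e.2 ∧ e.2 < d.2)

instance : DecidableRel Cross := fun d e => by unfold Cross; infer_instance

theorem Cross.symm {d e : ℤ × ℤ} (h : Cross d e) : Cross e d := Or.symm h

/-- The diagonals of the convex polygon with vertex set `A`. -/
def diagonals (A : Finset ℤ) : Finset (ℤ × ℤ) :=
  (A ×ˢ A).filter fun d => (∃ a ∈ A, d.1 < a ∧ a < d.2) ∧ ∃ a ∈ A, a < d.1 ∨ d.2 < a

/-- The sets of pairwise noncrossing diagonals of the polygon with vertex set `A`. -/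
def dissections (A : Finset ℤ) : Finset (Finset (ℤ × ℤ)) :=
  (diagonals A).powerset.filter fun D => ∀ d ∈ D, ∀ e ∈ D, ¬ Cross d e

theorem mem_diagonals {A : Finset ℤ} {d : ℤ × ℤ} : d ∈ diagonals A ↔
    d.1 ∈ A ∧ d.2 ∈ A ∧ (∃ a ∈ A, d.1 < a ∧ a < d.2) ∧ ∃ a ∈ A, a < d.1 ∨ d.2 < a := by
  simp [diagonals, and_assoc]

theorem mem_dissections {A : Finset ℤ} {D : Finset (ℤ × ℤ)} : D ∈ dissections A ↔
    (∀ d ∈ D, d ∈ diagonals A) ∧ ∀ d ∈ D, ∀ e ∈ D, ¬ Cross d e := by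
  simp [dissections, Finset.subset_iff]

theorem mem_diagonals_Icc {a b : ℤ} {d : ℤ × ℤ} : d ∈ diagonals (Icc a b) ↔
    a ≤ d.1 ∧ d.1 + 2 ≤ d.2 ∧ d.2 ≤ b ∧ (a < d.1 ∨ d.2 < b) := by
  simp only [mem_diagonals, mem_Icc]
  constructor
  · rintro ⟨h1, h2, ⟨c, h3, h4⟩, e, h5, h6⟩
    omega
  · rintro ⟨h1, h2, h3, h4⟩
    refine ⟨by omega, by omega, ⟨d.1 + 1, by omega⟩, ?_⟩
    rcases h4 with h | h
    · exact ⟨a, by omega⟩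
    · exact ⟨b, by omega⟩

variable {R : Type*} [CommRing R]

/-- The sum over all dissections of the product of the weights of the diagonals. -/
def dsum (A : Finset ℤ) (w : ℤ × ℤ → R) : R :=
  ∑ D ∈ dissections A, ∏ d ∈ D, w d

theorem dsum_congr {A : Finset ℤ} {w w' : ℤ × ℤ → R} (h : ∀ d ∈ diagonals A, w d = w' d) :
    dsum A w = dsum A w' :=
  Finset.sum_congr rfl fun _ hD => Finset.prod_congr rfl fun d hd =>
    h d ((mem_dissections.1 hD).1 d hd)

/-- Transport of the weighted sum along an order isomorphism of vertex sets. -/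
theorem dsum_image {A : Finset ℤ} {φ : ℤ → ℤ} (hφ : StrictMonoOn φ A) (w : ℤ × ℤ → R) :
    dsum (A.image φ) w = dsum A fun d => w (φ d.1, φ d.2) := by
  set ψ : ℤ × ℤ → ℤ × ℤ := fun d => (φ d.1, φ d.2) with hψ
  have lt_iff : ∀ a ∈ A, ∀ b ∈ A, (φ a < φ b ↔ a < b) := fun a ha b hb => hφ.lt_iff_lt ha hb
  have inj : Set.InjOn ψ (diagonals A) := by
    intro d hd e he h
    have hd := mem_diagonals.1 hd
    have he := mem_diagonals.1 he
    simp only [hψ, Prod.mk.injEq] at h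
    exact Prod.ext (hφ.injOn hd.1 he.1 h.1) (hφ.injOn hd.2.1 he.2.1 h.2)
  have cross : ∀ d ∈ diagonals A, ∀ e ∈ diagonals A, (Cross (ψ d) (ψ e) ↔ Cross d e) := by
    intro d hd e he
    have hd := mem_diagonals.1 hd
    have he := mem_diagonals.1 he
    simp only [Cross, hψ, lt_iff _ hd.1 _ he.1, lt_iff _ he.1 _ hd.2.1, lt_iff _ hd.2.1 _ he.2.1,
      lt_iff _ he.1 _ hd.1, lt_iff _ hd.1 _ he.2.1, lt_iff _ he.2.1 _ hd.2.1]
  have himg : diagonals (A.image φ) = (diagonals A).image ψ := by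
    ext ⟨p, q⟩
    simp only [mem_diagonals, mem_image, Prod.exists, hψ, Prod.mk.injEq]
    constructor
    · rintro ⟨⟨a, ha, rfl⟩, ⟨b, hb, rfl⟩, ⟨_, ⟨c, hc, rfl⟩, h1, h2⟩, _, ⟨e, he, rfl⟩, h3⟩
      rw [lt_iff _ ha _ hc] at h1
      rw [lt_iff _ hc _ hb] at h2
      rw [lt_iff _ he _ ha, lt_iff _ hb _ he] at h3
      exact ⟨a, b, ⟨ha, hb, ⟨c, hc, h1, h2⟩, e, he, h3⟩, rfl, rfl⟩
    · rintro ⟨a, b, ⟨ha, hb, ⟨c, hc, h1, h2⟩, e, he, h3⟩, rfl, rfl⟩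
      rw [← lt_iff _ ha _ hc] at h1
      rw [← lt_iff _ hc _ hb] at h2
      rw [← lt_iff _ he _ ha, ← lt_iff _ hb _ he] at h3
      exact ⟨⟨a, ha, rfl⟩, ⟨b, hb, rfl⟩, ⟨_, ⟨c, hc, rfl⟩, h1, h2⟩, _, ⟨e, he, rfl⟩, h3⟩
  symm
  refine Finset.sum_bij (fun D _ => D.image ψ) ?_ ?_ ?_ ?_
  · intro D hD
    rw [mem_dissections] at hD ⊢
    refine ⟨?_, ?_⟩
    · intro d hd
      obtain ⟨e, he, rfl⟩ := mem_image.1 hd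
      rw [himg]
      exact mem_image_of_mem _ (hD.1 e he)
    · intro d hd e he
      obtain ⟨d', hd', rfl⟩ := mem_image.1 hd
      obtain ⟨e', he', rfl⟩ := mem_image.1 he
      rw [cross _ (hD.1 _ hd') _ (hD.1 _ he')]
      exact hD.2 _ hd' _ he'
  · intro D hD E hE h
    have hD := (mem_dissections.1 hD).1
    have hE := (mem_dissections.1 hE).1
    have h' : ψ '' (D : Set (ℤ × ℤ)) = ψ '' E := by
      rw [← coe_image, ← coe_image]; exact congrArg _ h
    exact Finset.coe_injective ((inj.image_eq_image_iff hD hE).1 h')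
  · intro E hE
    rw [mem_dissections, himg] at hE
    refine ⟨(diagonals A).filter fun d => ψ d ∈ E, ?_, ?_⟩
    · rw [mem_dissections]
      refine ⟨fun d hd => (mem_filter.1 hd).1, fun d hd e he => ?_⟩
      rw [mem_filter] at hd he
      rw [← cross _ hd.1 _ he.1]
      exact hE.2 _ hd.2 _ he.2
    · ext e
      simp only [mem_image, mem_filter]
      constructor
      · rintro ⟨d, hd, rfl⟩; exact hd.2
      · intro he
        obtain ⟨d, hd, rfl⟩ := mem_image.1 (hE.1 e he)
        exact ⟨d, ⟨hd, he⟩, rfl⟩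
  · intro D hD
    rw [Finset.prod_image]
    exact inj.mono (mem_dissections.1 hD).1

/-- Cutting a polygon along a diagonal. -/
theorem sum_dissections_mem {A : Finset ℤ} {c : ℤ × ℤ} (hc : c ∈ diagonals A) (w : ℤ × ℤ → R) :
    ∑ D ∈ dissections A with c ∈ D, ∏ d ∈ D.erase c, w d =
      dsum (A.filter fun a => c.1 ≤ a ∧ a ≤ c.2) w *
        dsum (A.filter fun a => a ≤ c.1 ∨ c.2 ≤ a) w := by
  obtain ⟨p, q⟩ := c
  have hc' := mem_diagonals.1 hc
  simp only at hc'
  obtain ⟨hp, hq, ⟨a₀, ha₀, ha1, ha2⟩, b₀, hb₀, hb⟩ := hc'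
  -- The cut turns (p, q) into a side of both pieces, so it is a diagonal of neither.
  have memL : ∀ d, d ∈ diagonals (A.filter fun a => p ≤ a ∧ a ≤ q) ↔
      d ∈ diagonals A ∧ p ≤ d.1 ∧ d.2 ≤ q ∧ d ≠ (p, q) := by
    rintro ⟨a, b⟩
    simp only [mem_diagonals, mem_filter, ne_eq, Prod.mk.injEq]
    constructor
    · rintro ⟨h1, h2, ⟨c, h3, h4⟩, e, h5, h6⟩
      exact ⟨⟨h1.1, h2.1, ⟨c, h3.1, h4⟩, e, h5.1, h6⟩, by omega, by omega, by omega⟩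
    · rintro ⟨⟨h1, h2, ⟨c, h3, h4⟩, e, h5, h6⟩, h7, h8, h9⟩
      refine ⟨⟨h1, by omega⟩, ⟨h2, by omega⟩, ⟨c, ⟨h3, by omega⟩, h4⟩, ?_⟩
      by_cases h : p < a
      · exact ⟨p, ⟨hp, by omega⟩, by omega⟩
      · exact ⟨q, ⟨hq, by omega⟩, by omega⟩
  have memR : ∀ d, d ∈ diagonals (A.filter fun a => a ≤ p ∨ q ≤ a) ↔
      d ∈ diagonals A ∧ (d.1 ≤ p ∨ q ≤ d.1) ∧ (d.2 ≤ p ∨ q ≤ d.2) ∧ d ≠ (p, q) := by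
    rintro ⟨a, b⟩
    simp only [mem_diagonals, mem_filter, ne_eq, Prod.mk.injEq]
    constructor
    · rintro ⟨h1, h2, ⟨c, h3, h4⟩, e, h5, h6⟩
      exact ⟨⟨h1.1, h2.1, ⟨c, h3.1, h4⟩, e, h5.1, h6⟩, by omega, by omega, by omega⟩
    · rintro ⟨⟨h1, h2, ⟨c, h3, h4⟩, e, h5, h6⟩, h7, h8, h9⟩
      refine ⟨⟨h1, h7⟩, ⟨h2, h8⟩, ?_, ?_⟩
      -- The vertex separating a from b may lie in the part cut off; then p or q takes its place.
      · by_cases h : a < p ∧ p < b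
        · exact ⟨p, ⟨hp, by omega⟩, by omega⟩
        · by_cases h' : a < q ∧ q < b
          · exact ⟨q, ⟨hq, by omega⟩, by omega⟩
          · exact ⟨c, ⟨h3, by omega⟩, h4⟩
      · by_cases h : p < a ∨ b < p
        · exact ⟨p, ⟨hp, by omega⟩, by omega⟩
        · by_cases h' : q < a ∨ b < q
          · exact ⟨q, ⟨hq, by omega⟩, by omega⟩
          · exact ⟨e, ⟨h5, by omega⟩, h6⟩
  have excl : ∀ d, d ∈ diagonals (A.filter fun a => p ≤ a ∧ a ≤ q) →
      d ∉ diagonals (A.filter fun a => a ≤ p ∨ q ≤ a) := by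
    rintro ⟨a, b⟩ h h'
    rw [memL] at h
    rw [memR] at h'
    obtain ⟨-, -, ⟨c, -, h3⟩, -⟩ := mem_diagonals.1 h.1
    obtain ⟨-, h1, h2, h4⟩ := h
    obtain ⟨-, h1', h2', -⟩ := h'
    simp only [ne_eq, Prod.mk.injEq] at *
    omega
  have cover : ∀ d ∈ diagonals A, ¬ Cross d (p, q) → d ≠ (p, q) →
      d ∉ diagonals (A.filter fun a => p ≤ a ∧ a ≤ q) →
      d ∈ diagonals (A.filter fun a => a ≤ p ∨ q ≤ a) := by
    rintro ⟨a, b⟩ h h' h1 h2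
    rw [memL] at h2
    rw [memR]
    refine ⟨h, ?_⟩
    obtain ⟨-, -, ⟨c, -, h3⟩, -⟩ := mem_diagonals.1 h
    simp only [Cross, h, true_and, ne_eq, Prod.mk.injEq] at *
    omega
  have ncL : ∀ d, d ∈ diagonals (A.filter fun a => p ≤ a ∧ a ≤ q) →
      ¬ Cross d (p, q) ∧ ¬ Cross (p, q) d := by
    rintro ⟨a, b⟩ h
    rw [memL] at h
    obtain ⟨-, h1, h2, -⟩ := h
    simp only [Cross] at *
    omega
  have ncR : ∀ d, d ∈ diagonals (A.filter fun a => a ≤ p ∨ q ≤ a) →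
      ¬ Cross d (p, q) ∧ ¬ Cross (p, q) d := by
    rintro ⟨a, b⟩ h
    rw [memR] at h
    obtain ⟨-, h1, h2, -⟩ := h
    simp only [Cross] at *
    omega
  have ncLR : ∀ d ∈ diagonals (A.filter fun a => p ≤ a ∧ a ≤ q),
      ∀ e ∈ diagonals (A.filter fun a => a ≤ p ∨ q ≤ a), ¬ Cross d e := by
    rintro ⟨a, b⟩ h ⟨a', b'⟩ h'
    rw [memL] at h
    rw [memR] at h'
    obtain ⟨-, h1, h2, -⟩ := h
    obtain ⟨-, h1', h2', -⟩ := h'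
    simp only [Cross] at *
    omega
  rw [dsum, dsum, Finset.sum_mul_sum, ← Finset.sum_product']
  refine Finset.sum_bij'
    (fun D _ => (D.filter fun d => d ∈ diagonals (A.filter fun a => p ≤ a ∧ a ≤ q),
      D.filter fun d => d ∈ diagonals (A.filter fun a => a ≤ p ∨ q ≤ a)))
    (fun E _ => insert (p, q) (E.1 ∪ E.2)) ?_ ?_ ?_ ?_ ?_
  · intro D hD
    rw [mem_filter, mem_dissections] at hD
    rw [mem_product, mem_dissections, mem_dissections]
    refine ⟨⟨fun d hd => (mem_filter.1 hd).2, fun d hd e he => ?_⟩,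
      ⟨fun d hd => (mem_filter.1 hd).2, fun d hd e he => ?_⟩⟩
    · exact hD.1.2 d (mem_filter.1 hd).1 e (mem_filter.1 he).1
    · exact hD.1.2 d (mem_filter.1 hd).1 e (mem_filter.1 he).1
  · rintro ⟨E, E'⟩ hE
    rw [mem_product, mem_dissections, mem_dissections] at hE
    simp only at hE
    obtain ⟨⟨hE1, hE2⟩, hE3, hE4⟩ := hE
    rw [mem_filter, mem_dissections]
    refine ⟨⟨?_, ?_⟩, mem_insert_self _ _⟩
    · intro d hd
      simp only [mem_insert, mem_union] at hd
      rcases hd with rfl | hd | hd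
      · exact hc
      · exact ((memL d).1 (hE1 d hd)).1
      · exact ((memR d).1 (hE3 d hd)).1
    · intro d hd e he
      simp only [mem_insert, mem_union] at hd he
      rcases hd with rfl | hd | hd <;> rcases he with rfl | he | he
      · simp [Cross]
      · exact (ncL _ (hE1 _ he)).2
      · exact (ncR _ (hE3 _ he)).2
      · exact (ncL _ (hE1 _ hd)).1
      · exact hE2 _ hd _ he
      · exact ncLR _ (hE1 _ hd) _ (hE3 _ he)
      · exact (ncR _ (hE3 _ hd)).1
      · exact fun h => ncLR _ (hE1 _ he) _ (hE3 _ hd) h.symm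
      · exact hE4 _ hd _ he
  · intro D hD
    rw [mem_filter, mem_dissections] at hD
    ext d
    simp only [mem_insert, mem_union, mem_filter]
    constructor
    · rintro (rfl | h | h)
      · exact hD.2
      · exact h.1
      · exact h.1
    · intro h
      by_cases h1 : d = (p, q)
      · exact Or.inl h1
      · by_cases h2 : d ∈ diagonals (A.filter fun a => p ≤ a ∧ a ≤ q)
        · exact Or.inr (Or.inl ⟨h, h2⟩)
        · exact Or.inr (Or.inr ⟨h, cover d (hD.1.1 d h) (hD.1.2 _ h _ hD.2) h1 h2⟩)
  · rintro ⟨E, E'⟩ hE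
    rw [mem_product, mem_dissections, mem_dissections] at hE
    simp only at hE
    obtain ⟨⟨hE1, hE2⟩, hE3, hE4⟩ := hE
    have hL : (p, q) ∉ diagonals (A.filter fun a => p ≤ a ∧ a ≤ q) := fun h => by
      rw [memL] at h; simp at h
    have hR : (p, q) ∉ diagonals (A.filter fun a => a ≤ p ∨ q ≤ a) := fun h => by
      rw [memR] at h; simp at h
    ext d
    · simp only [mem_insert, mem_union, mem_filter]
      constructor
      · rintro ⟨rfl | h | h, h'⟩
        · exact absurd h' hL
        · exact h
        · exact absurd (hE3 d h) (excl d h')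
      · exact fun h => ⟨Or.inr (Or.inl h), hE1 d h⟩
    · simp only [mem_insert, mem_union, mem_filter]
      constructor
      · rintro ⟨rfl | h | h, h'⟩
        · exact absurd h' hR
        · exact absurd h' (excl d (hE1 d h))
        · exact h
      · exact fun h => ⟨Or.inr (Or.inr h), hE3 d h⟩
  · intro D hD
    rw [mem_filter, mem_dissections] at hD
    rw [← Finset.prod_union]
    · refine Finset.prod_congr ?_ fun _ _ => rfl
      ext d
      simp only [mem_erase, mem_union, mem_filter]
      constructor
      · rintro ⟨h1, h⟩
        by_cases h2 : d ∈ diagonals (A.filter fun a => p ≤ a ∧ a ≤ q)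
        · exact Or.inl ⟨h, h2⟩
        · exact Or.inr ⟨h, cover d (hD.1.1 d h) (hD.1.2 _ h _ hD.2) h1 h2⟩
      · rintro (⟨h, h'⟩ | ⟨h, h'⟩)
        · exact ⟨((memL d).1 h').2.2.2, h⟩
        · exact ⟨((memR d).1 h').2.2.2, h⟩
    · rw [Finset.disjoint_left]
      intro d hd hd'
      exact excl d (mem_filter.1 hd).2 (mem_filter.1 hd').2

/-- Changing the weight of one diagonal. -/
theorem dsum_sub_dsum {A : Finset ℤ} {c : ℤ × ℤ} (hc : c ∈ diagonals A) {w w' : ℤ × ℤ → R}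
    (h : ∀ d, d ≠ c → w d = w' d) :
    dsum A w = dsum A w' + (w c - w' c) *
      (dsum (A.filter fun a => c.1 ≤ a ∧ a ≤ c.2) w' *
        dsum (A.filter fun a => a ≤ c.1 ∨ c.2 ≤ a) w') := by
  rw [← sum_dissections_mem hc, dsum, dsum, Finset.mul_sum, Finset.sum_filter,
    ← Finset.sum_add_distrib]
  refine Finset.sum_congr rfl fun D _ => ?_
  split_ifs with hD
  · rw [← Finset.mul_prod_erase D w hD, ← Finset.mul_prod_erase D w' hD,
      Finset.prod_congr rfl fun d hd => h d (Finset.ne_of_mem_erase hd)]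
    ring
  · rw [add_zero]
    exact Finset.prod_congr rfl fun d hd => h d fun e => hD (e ▸ hd)

/-- The dissection polynomial of an `(n + 3)`-gon, evaluated at `u`. -/
def dpoly (u : R) (n : ℕ) : R := dsum (Icc 0 ((n : ℤ) + 2)) fun _ => u

theorem dsum_Icc_const (u : R) (a : ℤ) (n : ℕ) :
    dsum (Icc a (a + n + 2)) (fun _ => u) = dpoly u n := by
  have h := dsum_image (A := Icc (0 : ℤ) ((n : ℤ) + 2)) (φ := fun t => a + t)
    (fun x _ y _ h => by simpa using h) (fun _ => u)
  rw [Finset.image_add_left_Icc] at h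
  rw [dpoly, ← h]
  congr 2
  all_goals ring

/-- Closing the gap between p and q by a translation of the right-hand vertices is an order
isomorphism onto an interval, and constant weights are unaffected. -/
theorem dsum_outside_const (u : R) {a b p q : ℤ} {n : ℕ} (hp : a ≤ p) (hpq : p < q) (hq : q ≤ b)
    (hn : (n : ℤ) + 2 = b - a - (q - p - 1)) :
    dsum ((Icc a b).filter fun t => t ≤ p ∨ q ≤ t) (fun _ => u) = dpoly u n := by
  have h := dsum_image (A := (Icc a b).filter fun t => t ≤ p ∨ q ≤ t)
    (φ := fun t => if t ≤ p then t else t - (q - p - 1))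
    (fun x hx y hy h => by
      simp only [coe_filter, mem_Icc, Set.mem_ofPred_eq] at hx hy ⊢
      split_ifs <;> omega) (fun _ => u)
  rw [← h, ← dsum_Icc_const u a n]
  congr 1
  ext t
  simp only [mem_image, mem_filter, mem_Icc]
  constructor
  · rintro ⟨s, hs, rfl⟩
    split_ifs <;> omega
  · intro ht
    by_cases h' : t ≤ p
    · exact ⟨t, by omega, by rw [if_pos h']⟩
    · exact ⟨t + (q - p - 1), by omega, by rw [if_neg (by omega)]; ring⟩

/-! ### Weighted sums for nested triangulations -/

/-- A sequence which increases by `0` or `1` at each step. -/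
def IsSlice (x : ℕ → ℤ) : Prop := ∀ i, x i ≤ x (i + 1) ∧ x (i + 1) ≤ x i + 1

/-- The `i`-th diagonal of the triangulation of the polygon with vertices
`x 0, …, x 0 + n + 2` defined by the sequence `x`, for `1 ≤ i ≤ n`. -/
def arc (n : ℕ) (x : ℕ → ℤ) (i : ℕ) : ℤ × ℤ := (x i, x i + n + 2 - i)

theorem IsSlice.le {x : ℕ → ℤ} (hx : IsSlice x) {i j : ℕ} (h : i ≤ j) :
    x i ≤ x j ∧ x j ≤ x i + (j - i) := by
  induction j, h using Nat.le_induction with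
  | base => simp
  | succ j h ih =>
    have := hx j
    push_cast
    omega

theorem IsSlice.shift {x : ℕ → ℤ} (hx : IsSlice x) (s : ℕ) : IsSlice fun i => x (s + i) :=
  fun i => hx (s + i)

theorem arc_injective (n : ℕ) (x : ℕ → ℤ) : Function.Injective (arc n x) := by
  intro i j h
  simp only [arc, Prod.mk.injEq] at h
  omega

theorem arc_mem_diagonals {n : ℕ} {x : ℕ → ℤ} (hx : IsSlice x) {i : ℕ} (h1 : 1 ≤ i)
    (hn : i ≤ n) : arc n x i ∈ diagonals (Icc (x 0) (x 0 + n + 2)) := by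
  have := hx.le (Nat.zero_le i)
  rw [mem_diagonals_Icc]
  simp only [arc]
  push_cast at this
  omega

open Classical in
/-- The weight which is `v` on the diagonals `arc i` with `s ≤ i ≤ n` and `u` elsewhere. -/
def arcWeight (u v : R) (n : ℕ) (x : ℕ → ℤ) (s : ℕ) (d : ℤ × ℤ) : R :=
  if ∃ i, s ≤ i ∧ i ≤ n ∧ d = arc n x i then v else u

/-- The weighted sum over dissections, with weight `v` on a triangulation and `u` elsewhere. -/
def triangleSum (u v : R) (n : ℕ) (x : ℕ → ℤ) : R :=
  dsum (Icc (x 0) (x 0 + n + 2)) (arcWeight u v n x 1)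

/-- The arcs are nested, so cutting along arc s+1 leaves all later arcs on the inner side, where
they form the triangulation of the shifted sequence. The outer side is an (s+3)-gon on which only
weight u occurs. -/
theorem dsum_arcWeight_succ (u v : R) {n : ℕ} {x : ℕ → ℤ} (hx : IsSlice x) {s : ℕ} (hs : s < n) :
    dsum (Icc (x 0) (x 0 + n + 2)) (arcWeight u v n x (s + 1)) =
      dsum (Icc (x 0) (x 0 + n + 2)) (arcWeight u v n x (s + 2)) +
        (v - u) * dpoly u s * triangleSum u v (n - 1 - s) fun i => x (s + 1 + i) := by
  have hle := hx.le (Nat.zero_le (s + 1))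
  push_cast at hle
  rw [dsum_sub_dsum (arc_mem_diagonals hx (Nat.le_add_left 1 s) hs)
    (w' := arcWeight u v n x (s + 2))]
  · have e1 : arcWeight u v n x (s + 1) (arc n x (s + 1)) = v :=
      if_pos ⟨s + 1, le_rfl, hs, rfl⟩
    have e2 : arcWeight u v n x (s + 2) (arc n x (s + 1)) = u := by
      refine if_neg ?_
      rintro ⟨i, h1, -, h⟩
      have := arc_injective n x h
      omega
    have e3 : dsum ((Icc (x 0) (x 0 + n + 2)).filter fun a =>
        (arc n x (s + 1)).1 ≤ a ∧ a ≤ (arc n x (s + 1)).2) (arcWeight u v n x (s + 2)) =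
        triangleSum u v (n - 1 - s) fun i => x (s + 1 + i) := by
      have hset : ((Icc (x 0) (x 0 + n + 2)).filter fun a =>
          (arc n x (s + 1)).1 ≤ a ∧ a ≤ (arc n x (s + 1)).2) =
          Icc (x (s + 1 + 0)) (x (s + 1 + 0) + ((n - 1 - s : ℕ) : ℤ) + 2) := by
        ext a
        rw [mem_filter]
        simp only [mem_Icc, arc, add_zero]
        push_cast
        omega
      rw [triangleSum, hset]
      refine dsum_congr fun d _ => ?_
      rw [arcWeight, arcWeight]
      congr 1
      refine propext ⟨?_, ?_⟩
      · rintro ⟨i, h1, h2, rfl⟩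
        refine ⟨i - (s + 1), by omega, by omega, ?_⟩
        have : s + 1 + (i - (s + 1)) = i := by omega
        simp only [arc, this, Prod.mk.injEq, true_and]
        omega
      · rintro ⟨i, h1, h2, rfl⟩
        refine ⟨s + 1 + i, by omega, by omega, ?_⟩
        simp only [arc, Prod.mk.injEq, true_and]
        push_cast
        omega
    have e4 : dsum ((Icc (x 0) (x 0 + n + 2)).filter fun a =>
        a ≤ (arc n x (s + 1)).1 ∨ (arc n x (s + 1)).2 ≤ a) (arcWeight u v n x (s + 2)) =
        dpoly u s := by
      rw [← dsum_outside_const u (a := x 0) (b := x 0 + n + 2) (p := (arc n x (s + 1)).1)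
        (q := (arc n x (s + 1)).2)]
      · refine dsum_congr fun d hd => if_neg ?_
        rintro ⟨i, h1, h2, rfl⟩
        have := hx.le (show s + 1 ≤ i by omega)
        obtain ⟨h3, h4, -⟩ := mem_diagonals.1 hd
        rw [mem_filter] at h3 h4
        simp only [arc] at h3 h4
        push_cast at *
        omega
      all_goals simp only [arc]; push_cast; omega
    rw [e1, e2, e3, e4]
    ring
  · intro d hd
    rw [arcWeight, arcWeight]
    congr 1
    refine propext ⟨?_, ?_⟩
    · rintro ⟨i, h1, h2, rfl⟩
      refine ⟨i, ?_, h2, rfl⟩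
      rcases h1.lt_or_eq with h | rfl
      · exact h
      · exact absurd rfl hd
    · rintro ⟨i, h1, h2, rfl⟩
      exact ⟨i, by omega, h2, rfl⟩

/-- The weights are lowered from v to u starting with the longest arc, and the differences
telescope. The sequence `x` enters the right-hand side only through shorter sums of the same kind.
-/
theorem triangleSum_eq (u v : R) (n : ℕ) {x : ℕ → ℤ} (hx : IsSlice x) :
    triangleSum u v n x = dpoly u n + ∑ s ∈ range n,
      (v - u) * dpoly u s * triangleSum u v (n - 1 - s) fun i => x (s + 1 + i) := by
  have key : ∀ m ≤ n, triangleSum u v n x =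
      dsum (Icc (x 0) (x 0 + n + 2)) (arcWeight u v n x (m + 1)) + ∑ s ∈ range m,
      (v - u) * dpoly u s * triangleSum u v (n - 1 - s) fun i => x (s + 1 + i) := by
    intro m
    induction m with
    | zero => intro _; simp [triangleSum]
    | succ m ih =>
      intro hm
      rw [ih (by omega), dsum_arcWeight_succ u v hx (by omega), Finset.sum_range_succ]
      ring
  rw [key n le_rfl, ← dsum_Icc_const u (x 0) n]
  congr 1
  refine dsum_congr fun d _ => if_neg ?_
  rintro ⟨i, h1, h2, -⟩
  omega

theorem dsum_eq_of_subset {A B : Finset ℤ} (h : diagonals B ⊆ diagonals A) {w : ℤ × ℤ → R}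
    (hw : ∀ d ∈ diagonals A, d ∉ diagonals B → w d = 0) : dsum A w = dsum B w := by
  symm
  refine Finset.sum_subset (fun D hD => ?_) fun D hD hD' => ?_
  · rw [mem_dissections] at hD ⊢
    exact ⟨fun d hd => h (hD.1 d hd), hD.2⟩
  · rw [mem_dissections] at hD hD'
    have : ∃ d ∈ D, d ∉ diagonals B := by
      by_contra hcon
      push Not at hcon
      exact hD' ⟨hcon, hD.2⟩
    obtain ⟨d, hd, hd'⟩ := this
    exact Finset.prod_eq_zero hd (hw d (hD.1 d hd) hd')

theorem dpoly_zero (u : R) : dpoly u 0 = 1 := by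
  have h : diagonals (Icc 0 (((0 : ℕ) : ℤ) + 2)) = ∅ := by
    ext d
    rw [mem_diagonals_Icc]
    simp only [notMem_empty, iff_false]
    omega
  rw [dpoly, dsum, dissections, h]
  simp [Finset.filter_singleton]

/-- The fan triangulation at the last vertex. -/
theorem triangleSum_fan (u : R) (n : ℕ) :
    triangleSum u 0 (n + 1) (fun i => (i : ℤ)) = (1 + u) * dpoly u n := by
  have hx : IsSlice fun i => (i : ℤ) := fun i => by push_cast; omega
  have hA : Icc (((0 : ℕ) : ℤ)) (((0 : ℕ) : ℤ) + ((n + 1 : ℕ) : ℤ) + 2) = Icc 0 ((n : ℤ) + 3) := by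
    congr 1; push_cast; ring
  have hw : ∀ d ∈ diagonals (Icc 0 ((n : ℤ) + 3)),
      arcWeight u 0 (n + 1) (fun i => (i : ℤ)) 1 d = if d.2 = n + 3 then 0 else u := by
    intro d hd
    rw [mem_diagonals_Icc] at hd
    rw [arcWeight]
    congr 1
    refine propext ⟨?_, fun h => ⟨d.1.toNat, by omega, by omega, ?_⟩⟩
    · rintro ⟨i, h1, h2, rfl⟩
      simp only [arc]; push_cast; ring
    · refine Prod.ext ?_ ?_ <;> simp only [arc] <;> push_cast <;> omega
  have hc : ((0 : ℤ), (n : ℤ) + 2) ∈ diagonals (Icc 0 ((n : ℤ) + 3)) := by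
    rw [mem_diagonals_Icc]; simp only; omega
  have hL : ((Icc 0 ((n : ℤ) + 3)).filter fun a => (0 : ℤ) ≤ a ∧ a ≤ (n : ℤ) + 2) =
      Icc 0 ((n : ℤ) + 2) := by
    ext a
    simp only [mem_filter, mem_Icc]
    omega
  -- With weight 0 on the fan, no diagonal ends at the last vertex. The diagonal (0, n+2) cutting
  -- this vertex off is then free to be present or absent, giving the factor 1+u.
  rw [triangleSum, hA, dsum_congr hw, dsum_sub_dsum hc
    (w' := fun d => if d.2 = n + 3 ∨ d = (0, (n : ℤ) + 2) then 0 else u)]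
  · have h1 : dsum (Icc 0 ((n : ℤ) + 2))
        (fun d => if d.2 = n + 3 ∨ d = (0, (n : ℤ) + 2) then 0 else u) = dpoly u n := by
      refine dsum_congr fun d hd => if_neg ?_
      rw [mem_diagonals_Icc] at hd
      rintro (h | rfl)
      · omega
      · simp only at hd
        omega
    have h2 : dsum (Icc 0 ((n : ℤ) + 3))
        (fun d => if d.2 = n + 3 ∨ d = (0, (n : ℤ) + 2) then 0 else u) = dpoly u n := by
      rw [← h1]
      refine dsum_eq_of_subset (fun d hd => ?_) fun d hd hd' => if_pos ?_
      · rw [mem_diagonals_Icc] at hd ⊢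
        omega
      · rw [mem_diagonals_Icc] at hd hd'
        rw [Prod.ext_iff]
        simp only
        omega
    have h3 : dsum ((Icc 0 ((n : ℤ) + 3)).filter fun a => a ≤ (0 : ℤ) ∨ (n : ℤ) + 2 ≤ a)
        (fun d => if d.2 = n + 3 ∨ d = (0, (n : ℤ) + 2) then 0 else u) = 1 := by
      rw [← dpoly_zero u, ← dsum_outside_const u (a := 0) (b := (n : ℤ) + 3) (p := 0)
        (q := (n : ℤ) + 2) le_rfl (by omega) (by omega) (by push_cast; omega)]
      refine dsum_congr fun d hd => ?_
      obtain ⟨h3, h4, ⟨c, hc, h5⟩, e, he, h6⟩ := mem_diagonals.1 hd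
      simp only [mem_filter, mem_Icc] at h3 h4 hc he
      omega
    simp only
    rw [hL, h1, h2, h3]
    simp
    ring
  · intro d hd
    simp [hd]

end Dissection

/-! ### Independence of the triangulation and generating series -/

namespace Dissection

open Finset

variable {R : Type*} [CommRing R]

theorem isSlice_natCast : IsSlice fun i => (i : ℤ) := fun i => by push_cast; omega

/-- The weighted sum does not depend on the shape of the triangulation. -/
theorem triangleSum_eq_fan (u v : R) (n : ℕ) {x : ℕ → ℤ} (hx : IsSlice x) :
    triangleSum u v n x = triangleSum u v n fun i => (i : ℤ) := by
  induction n using Nat.strong_induction_on generalizing x with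
  | _ n ih =>
    rw [triangleSum_eq u v n hx, triangleSum_eq u v n isSlice_natCast, add_right_inj]
    refine Finset.sum_congr rfl fun s hs => ?_
    rw [mem_range] at hs
    rw [ih (n - 1 - s) (by omega) (hx.shift (s + 1)),
      ih (n - 1 - s) (by omega) (isSlice_natCast.shift (s + 1))]

/-- The sums over dissections with weight `v` on a triangulation and `u` elsewhere. -/
def triangle (u v : R) (n : ℕ) : R := triangleSum u v n fun i => (i : ℤ)

theorem triangle_eq (u v : R) (n : ℕ) : triangle u v n =
    dpoly u n + ∑ s ∈ range n, (v - u) * dpoly u s * triangle u v (n - 1 - s) := by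
  rw [triangle, triangleSum_eq u v n isSlice_natCast, add_right_inj]
  refine Finset.sum_congr rfl fun s _ => ?_
  rw [triangleSum_eq_fan u v _ (isSlice_natCast.shift (s + 1)), triangle]

theorem triangle_zero (u v : R) : triangle u v 0 = 1 := by
  rw [triangle_eq, Finset.sum_range_zero, dpoly_zero, add_zero]

open PowerSeries in
theorem mk_triangle (u v : R) : PowerSeries.mk (triangle u v) = PowerSeries.mk (dpoly u) +
    PowerSeries.C (v - u) * X * PowerSeries.mk (dpoly u) * PowerSeries.mk (triangle u v) := by
  ext n
  rw [map_add, mul_assoc, mul_assoc, coeff_C_mul, coeff_mk, coeff_mk]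
  cases n with
  | zero => simp [triangle_zero, dpoly_zero]
  | succ n =>
    rw [coeff_succ_X_mul, coeff_mul, triangle_eq u v (n + 1),
      Finset.Nat.sum_antidiagonal_eq_sum_range_succ_mk, Finset.mul_sum, add_right_inj]
    refine Finset.sum_congr rfl fun s _ => ?_
    rw [coeff_mk, coeff_mk, mul_assoc]
    rfl

theorem triangle_zero_right_succ (u : R) (n : ℕ) :
    triangle u 0 (n + 1) = (1 + u) * dpoly u n := triangleSum_fan u n

open PowerSeries in
-- Two evaluations of the series for v = 0 are compared: the fan count and the general recursion.
theorem mk_dpoly (u : R) : PowerSeries.mk (dpoly u) =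
    (1 + PowerSeries.C (1 + u) * X * PowerSeries.mk (dpoly u)) *
      (1 + PowerSeries.C u * X * PowerSeries.mk (dpoly u)) := by
  have h1 : PowerSeries.mk (triangle u 0) =
      1 + PowerSeries.C (1 + u) * X * PowerSeries.mk (dpoly u) := by
    ext n
    rw [map_add, mul_assoc, coeff_C_mul, coeff_mk]
    cases n with
    | zero => simp [triangle_zero]
    | succ n =>
      rw [coeff_succ_X_mul, coeff_mk, triangle_zero_right_succ, coeff_one, if_neg (by omega),
        zero_add]
  have h2 := mk_triangle u 0
  rw [← h1]
  rw [zero_sub, map_neg] at h2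
  linear_combination -h2

open Polynomial in
-- The recursion for v = 0, solved for the dissection polynomial, expresses it through smaller ones;
-- the degree bound follows by strong induction.
theorem natDegree_dpoly_le (n : ℕ) : (dpoly (X : ℤ[X]) n).natDegree ≤ n := by
  induction n using Nat.strong_induction_on with
  | _ n ih =>
    have hP : ∀ m ≤ n, (triangle (X : ℤ[X]) 0 m).natDegree ≤ m := by
      intro m hm
      cases m with
      | zero => simp [triangle_zero]
      | succ m =>
        rw [triangle_zero_right_succ]
        refine natDegree_mul_le.trans ?_
        have h1 : (1 + X : ℤ[X]).natDegree ≤ 1 := by compute_degree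
        have := ih m (by omega)
        omega
    have h := triangle_eq (X : ℤ[X]) 0 n
    have h' : dpoly (X : ℤ[X]) n = triangle X 0 n +
        ∑ s ∈ range n, X * dpoly X s * triangle X 0 (n - 1 - s) := by
      rw [h, add_assoc, ← Finset.sum_add_distrib, Finset.sum_eq_zero, add_zero]
      intro s _
      ring
    rw [h']
    refine natDegree_add_le_of_degree_le (hP n le_rfl) (natDegree_sum_le_of_forall_le _ _ ?_)
    intro s hs
    rw [mem_range] at hs
    refine natDegree_mul_le.trans ?_
    have h1 : (X * dpoly X s : ℤ[X]).natDegree ≤ 1 + s :=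
      natDegree_mul_le.trans (add_le_add natDegree_X_le (ih s hs))
    have := hP (n - 1 - s) (by omega)
    omega

open Polynomial in
/-- A dissection of an `(n + 3)`-gon has at most `n` diagonals. -/
theorem card_le_of_mem_dissections {n : ℕ} {D : Finset (ℤ × ℤ)}
    (hD : D ∈ dissections (Icc 0 ((n : ℤ) + 2))) : D.card ≤ n := by
  by_contra! hcon
  have h0 := coeff_eq_zero_of_natDegree_lt ((natDegree_dpoly_le n).trans_lt hcon)
  -- The coefficient of `X ^ D.card` counts the dissections of that size, so nothing can cancel the
  -- contribution of `D`.
  simp only [dpoly, dsum, prod_const, finsetSum_coeff, coeff_X_pow] at h0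
  rw [Finset.sum_eq_zero_iff_of_nonneg (fun _ _ => by split_ifs <;> simp)] at h0
  simpa using h0 D hD

end Dissection

/-! ### The coefficients of the `Γ`-triangle -/

namespace GammaTriangle

open Polynomial

/-- The coefficient of `t ^ r` in `R ^ m`, where `R = 1 - t R + (t + z t ^ 2) R ^ 2`, as a
polynomial in `z`. -/
def powCoeff : ℕ → ℕ → ℤ[X]
  | 0, r => if r = 0 then 1 else 0
  | _ + 1, 0 => 1
  | m + 1, 1 => powCoeff m 1 - powCoeff (m + 1) 0 + powCoeff (m + 2) 0
  | m + 1, r + 2 => powCoeff m (r + 2) - powCoeff (m + 1) (r + 1) + powCoeff (m + 2) (r + 1) +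
      X * powCoeff (m + 2) r
termination_by m r => (r, m)

theorem powCoeff_zero_right (m : ℕ) : powCoeff m 0 = 1 := by
  cases m <;> simp [powCoeff]

theorem powCoeff_one_right (m : ℕ) : powCoeff m 1 = 0 := by
  induction m with
  | zero => simp [powCoeff]
  | succ m ih => rw [powCoeff, ih, powCoeff_zero_right, powCoeff_zero_right]; simp

theorem powCoeff_zero_left_succ (r : ℕ) : powCoeff 0 (r + 1) = 0 := by
  simp [powCoeff]

theorem powCoeff_succ_add_two (m r : ℕ) : powCoeff (m + 1) (r + 2) =
    powCoeff m (r + 2) - powCoeff (m + 1) (r + 1) + powCoeff (m + 2) (r + 1) +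
      X * powCoeff (m + 2) r := by
  rw [powCoeff]

theorem coeff_zero_powCoeff_succ (m r : ℕ) : (powCoeff m (r + 1)).coeff 0 = 0 := by
  induction r generalizing m with
  | zero => simp [powCoeff_one_right]
  | succ r ih =>
    induction m with
    | zero => simp [powCoeff_zero_left_succ]
    | succ m ihm => simp [powCoeff_succ_add_two, ihm, ih]

/-- Every factor z comes with t^2. This produces the support condition on the Γ-triangle. -/
theorem coeff_powCoeff_of_lt (m : ℕ) {r k : ℕ} (h : r < 2 * k) : (powCoeff m r).coeff k = 0 := by
  induction r using Nat.strong_induction_on generalizing m k with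
  | _ r ih =>
    match r with
    | 0 => rw [powCoeff_zero_right, coeff_one, if_neg (by omega)]
    | 1 => simp [powCoeff_one_right]
    | r + 2 =>
      induction m with
      | zero => simp [powCoeff_zero_left_succ]
      | succ m ihm =>
        obtain ⟨k, rfl⟩ : ∃ j, k = j + 1 := ⟨k - 1, by omega⟩
        rw [powCoeff_succ_add_two, coeff_add, coeff_X_mul, coeff_add, coeff_sub, ihm,
          ih (r + 1) (by omega) _ (by omega), ih (r + 1) (by omega) _ (by omega),
          ih r (by omega) _ (by omega)]
        simp

/-- The binomial identity behind the closed formula. -/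
theorem choose_identity (m k s : ℕ) :
    ((m : ℚ) + 1) * (s + k + 1).choose (k + 1) * (m + s + 2 * k + 4).choose (k + 1)
      - m * (s + k + 1).choose (k + 1) * (m + s + 2 * k + 3).choose (k + 1)
      + (m + 1) * (s + k).choose (k + 1) * (m + s + 2 * k + 3).choose (k + 1)
      - (m + 2) * (s + k).choose (k + 1) * (m + s + 2 * k + 4).choose (k + 1)
      = (k + 2) / (k + 1) * ((m + 2) * (s + k).choose k * (m + s + 2 * k + 3).choose k) := by
  have h1 : ((s + k + 1).choose (k + 1) : ℚ) = (s + k).choose k + (s + k).choose (k + 1) := by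
    rw [Nat.choose_succ_succ]; push_cast; rfl
  have h2 : ((m + s + 2 * k + 4).choose (k + 1) : ℚ) =
      (m + s + 2 * k + 3).choose k + (m + s + 2 * k + 3).choose (k + 1) := by
    rw [Nat.choose_succ_succ]; push_cast; rfl
  have h3 : ((s + k).choose (k + 1) : ℚ) = s / (k + 1) * (s + k).choose k := by
    have := Nat.choose_succ_right_eq (s + k) k
    rw [show s + k - k = s by omega] at this
    have h : ((s + k).choose (k + 1) : ℚ) * (k + 1) = (s + k).choose k * s := by exact_mod_cast this
    field_simp
    linarith
  have h4 : ((m + s + 2 * k + 3).choose (k + 1) : ℚ) =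
      (m + s + k + 3) / (k + 1) * (m + s + 2 * k + 3).choose k := by
    have := Nat.choose_succ_right_eq (m + s + 2 * k + 3) k
    rw [show m + s + 2 * k + 3 - k = m + s + k + 3 by omega] at this
    have h : ((m + s + 2 * k + 3).choose (k + 1) : ℚ) * (k + 1) =
        (m + s + 2 * k + 3).choose k * (m + s + k + 3) := by exact_mod_cast this
    field_simp
    linarith
  -- All binomials are now rational multiples of `(s + k).choose k` and `(m + s + 2 * k + 3).choose
  -- k`.
  rw [h1, h2, h3, h4]
  field_simp
  ring

/-- The closed formula for the coefficients, with `r = s + 2 k + 2`. -/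
theorem coeff_powCoeff (m k s : ℕ) : ((powCoeff m (s + 2 * k + 2)).coeff (k + 1) : ℚ) =
    m / (k + 1) * (s + k).choose k * (m + s + 2 * k + 1).choose k := by
  induction h : s + 2 * k using Nat.strong_induction_on generalizing m k s with
  | _ N ih =>
    subst h
    induction m with
    | zero => simp [powCoeff_zero_left_succ]
    | succ m ihm =>
      rw [powCoeff_succ_add_two, coeff_add, coeff_X_mul, coeff_add, coeff_sub]
      push_cast
      rw [ihm]
      cases k with
      | zero =>
        cases s with
        | zero => simp [powCoeff_one_right, powCoeff_zero_right]
        | succ s =>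
          have h1 := fun m => ih s (by omega) m 0 s rfl
          simp only [zero_add, Nat.choose_zero_right] at h1 ⊢
          rw [show s + 1 + 2 * 0 + 1 = s + 2 by ring, h1, h1,
            show s + 1 + 2 * 0 = s + 1 by ring, coeff_zero_powCoeff_succ]
          push_cast
          ring
      | succ k =>
        -- This is the closed formula at s-1. It persists for s = 0, where the coefficient and the
        -- binomial `k.choose (k + 1)` both vanish.
        have hlow : ∀ m : ℕ, ((powCoeff m (s + 2 * (k + 1) + 1)).coeff (k + 1 + 1) : ℚ) =
            m / (k + 2) * (s + k).choose (k + 1) * (m + s + 2 * k + 2).choose (k + 1) := by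
          intro m
          cases s with
          | zero =>
            rw [coeff_powCoeff_of_lt m (by omega)]
            simp
          | succ s =>
            rw [show s + 1 + 2 * (k + 1) + 1 = s + 2 * (k + 1) + 2 by ring,
              ih (s + 2 * (k + 1)) (by omega) m (k + 1) s rfl,
              show s + (k + 1) = s + 1 + k by ring,
              show m + s + 2 * (k + 1) + 1 = m + (s + 1) + 2 * k + 2 by ring]
            push_cast
            ring
        have hlast := ih (s + 2 * k) (by omega) (m + 2) k s rfl
        have hid := choose_identity m k s
        rw [hlow, hlow, show s + 2 * (k + 1) = s + 2 * k + 2 by ring, hlast,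
          show s + (k + 1) = s + k + 1 by ring,
          show m + s + 2 * (k + 1) + 1 = m + s + 2 * k + 3 by ring,
          show m + 1 + s + 2 * k + 2 = m + s + 2 * k + 3 by ring,
          show m + 2 + s + 2 * k + 2 = m + s + 2 * k + 4 by ring,
          show m + 2 + s + 2 * k + 1 = m + s + 2 * k + 3 by ring,
          show m + 1 + s + 2 * (k + 1) + 1 = m + s + 2 * k + 4 by ring]
        push_cast
        rw [show (k : ℚ) + 1 + 1 = k + 2 by ring]
        field_simp at hid ⊢
        linear_combination -hid

/-- A power series satisfying the quadratic equation has the coefficients `powCoeff`. -/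
theorem coeff_pow_eq_aeval {K : Type*} [Field K] (z : K) {R : PowerSeries K}
    (hR : R = 1 - PowerSeries.X * R + PowerSeries.X * R ^ 2 +
      PowerSeries.C z * (PowerSeries.X * (PowerSeries.X * R ^ 2)))
    (m r : ℕ) : PowerSeries.coeff r (R ^ m) = aeval z (powCoeff m r) := by
  have h0 : PowerSeries.constantCoeff R = 1 := by
    rw [hR]; simp
  -- The quadratic equation times R^m is exactly the recursion defining `powCoeff`.
  have hpow : ∀ m, R ^ (m + 1) = R ^ m - PowerSeries.X * R ^ (m + 1) +
      PowerSeries.X * R ^ (m + 2) +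
      PowerSeries.C z * (PowerSeries.X * (PowerSeries.X * R ^ (m + 2))) := by
    intro m
    linear_combination R ^ m * hR
  have hr0 : ∀ m, PowerSeries.coeff 0 (R ^ m) = aeval z (powCoeff m 0) := by
    intro m
    simp [powCoeff_zero_right, h0]
  have hr1 : ∀ m, PowerSeries.coeff 1 (R ^ m) = aeval z (powCoeff m 1) := by
    intro m
    induction m with
    | zero => simp [powCoeff_one_right, PowerSeries.coeff_one]
    | succ m ih =>
      rw [hpow]
      simp only [map_add, map_sub, PowerSeries.coeff_C_mul]
      rw [show (1 : ℕ) = 0 + 1 from rfl, PowerSeries.coeff_succ_X_mul,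
        PowerSeries.coeff_succ_X_mul, PowerSeries.coeff_succ_X_mul, zero_add, ih, hr0, hr0]
      simp [powCoeff_one_right, powCoeff_zero_right]
  induction r using Nat.strong_induction_on generalizing m with
  | _ r ih =>
    match r with
    | 0 => exact hr0 m
    | 1 => exact hr1 m
    | r + 2 =>
      induction m with
      | zero => simp [powCoeff_zero_left_succ, PowerSeries.coeff_one]
      | succ m ihm =>
        rw [hpow, powCoeff_succ_add_two]
        simp only [map_add, map_sub, map_mul, PowerSeries.coeff_C_mul,
          PowerSeries.coeff_succ_X_mul, aeval_X]
        rw [ihm, ih (r + 1) (by omega), ih (r + 1) (by omega), ih r (by omega)]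

end GammaTriangle

/-! ### Change of variables from dissections to the Γ-triangle -/

namespace GammaTriangle

open Polynomial Dissection

/-- This is the geometric expansion of R/(1-wtR): substituting the equation into itself m times
leaves a remainder divisible by t^m, and m = n+1 is enough. -/
theorem coeff_of_eq_add_mul {K : Type*} [Field K] {w : K} {R G : PowerSeries K}
    (hG : G = R + PowerSeries.C w * (PowerSeries.X * (R * G))) (n : ℕ) :
    PowerSeries.coeff n G =
      ∑ j ∈ Finset.range (n + 1), w ^ j * PowerSeries.coeff (n - j) (R ^ (j + 1)) := by
  have key : ∀ m, G = ∑ j ∈ Finset.range m,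
      PowerSeries.C (w ^ j) * (PowerSeries.X ^ j * R ^ (j + 1)) +
      PowerSeries.X ^ m * (PowerSeries.C (w ^ m) * (R ^ m * G)) := by
    intro m
    induction m with
    | zero => simp
    | succ m ih =>
      rw [Finset.sum_range_succ]
      simp only [map_pow] at ih ⊢
      linear_combination ih + PowerSeries.X ^ m * PowerSeries.C w ^ m * R ^ m * hG
  conv_lhs => rw [key (n + 1)]
  rw [map_add, PowerSeries.coeff_X_pow_mul', if_neg (by omega), add_zero, map_sum]
  refine Finset.sum_congr rfl fun j hj => ?_
  rw [Finset.mem_range] at hj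
  rw [PowerSeries.coeff_C_mul, PowerSeries.coeff_X_pow_mul', if_pos (by omega)]

/-- The change of variables from the `F`-triangle to the `Γ`-triangle. -/
theorem triangle_eq_sum_powCoeff {K : Type*} [Field K] {x : K} (y : K) (h1 : 1 - x ≠ 0)
    (h2 : 1 + x ≠ 0) (n : ℕ) :
    (1 - x) ^ n * triangle (x / (1 - x)) (x * y / (1 - x)) n =
      (1 + x) ^ n * ∑ j ∈ Finset.range (n + 1), ((1 + x * y) / (1 + x)) ^ j *
        aeval (x / (1 + x) ^ 2) (powCoeff (j + 1) (n - j)) := by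
  set u := x / (1 - x) with hu
  set v := x * y / (1 - x) with hv
  set z := x / (1 + x) ^ 2 with hz
  set w := (1 + x * y) / (1 + x) with hw
  -- This rescaling makes (1+u)ρ and uρ have sum 1 and product z, and makes (v-u)ρ equal to w-1.
  set ρ := (1 - x) / (1 + x) with hρ
  set g := PowerSeries.rescale ρ (PowerSeries.mk (dpoly u)) with hg
  set G := PowerSeries.rescale ρ (PowerSeries.mk (triangle u v)) with hG
  have rC : ∀ a, PowerSeries.rescale ρ (PowerSeries.C a) = PowerSeries.C a := by
    intro a
    ext k
    rw [PowerSeries.coeff_rescale, PowerSeries.coeff_C]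
    split_ifs with h <;> simp [h]
  have eg : g = 1 + PowerSeries.X * g +
      PowerSeries.C z * PowerSeries.X ^ 2 * g ^ 2 := by
    have h := congrArg (PowerSeries.rescale ρ) (mk_dpoly u)
    simp only [map_mul, map_add, map_one, PowerSeries.rescale_X] at h
    rw [rC, ← hg] at h
    have e1 : PowerSeries.C (1 + u) * PowerSeries.C ρ + PowerSeries.C u * PowerSeries.C ρ = 1 := by
      rw [← map_mul, ← map_mul, ← map_add, ← map_one PowerSeries.C]
      congr 1
      rw [hu, hρ]; field_simp; ring
    have e2 : PowerSeries.C (1 + u) * PowerSeries.C ρ * (PowerSeries.C u * PowerSeries.C ρ) =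
        PowerSeries.C z := by
      rw [← map_mul, ← map_mul, ← map_mul]
      congr 1
      rw [hu, hρ, hz]; field_simp; ring
    rw [map_add, map_one] at e1 e2
    linear_combination h + PowerSeries.X * g * e1 + PowerSeries.X ^ 2 * g ^ 2 * e2
  have eG : G = g + PowerSeries.C (w - 1) * PowerSeries.X * g * G := by
    have h := congrArg (PowerSeries.rescale ρ) (mk_triangle u v)
    simp only [map_mul, map_add, PowerSeries.rescale_X] at h
    rw [rC, ← hg, ← hG] at h
    have e1 : PowerSeries.C (v - u) * PowerSeries.C ρ = PowerSeries.C (w - 1) := by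
      rw [← map_mul]
      congr 1
      rw [hu, hv, hρ, hw]; field_simp; ring
    linear_combination h + PowerSeries.X * g * G * e1
  -- The equation g = 1 + tg + zt^2g^2 says 1/g = 1/R - t for this R. With 1/G = 1/g - (w-1)t it
  -- yields 1/G = 1/R - wt; the identities below are division-free forms of this.
  set R := (1 - PowerSeries.C z * PowerSeries.X ^ 2 * g)⁻¹ with hR
  have eR : R * (1 - PowerSeries.C z * PowerSeries.X ^ 2 * g) = 1 := by
    rw [hR, PowerSeries.inv_mul_cancel]
    simp
  have hg0 : g ≠ 0 := by
    intro h
    rw [h] at eg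
    simp at eg
  have eg' : g = R + PowerSeries.X * R * g := by
    linear_combination R * eg - g * eR
  have eR' : R = 1 - PowerSeries.X * R + PowerSeries.X * R ^ 2 +
      PowerSeries.C z * (PowerSeries.X * (PowerSeries.X * R ^ 2)) := by
    linear_combination (1 - PowerSeries.X * R) * eR +
      PowerSeries.C z * PowerSeries.X ^ 2 * R * eg'
  have eG' : G = R + PowerSeries.C w * (PowerSeries.X * (R * G)) := by
    refine mul_left_cancel₀ hg0 ?_
    rw [map_sub, map_one] at eG
    linear_combination R * eG + G * eg'
  have hcoeff := coeff_of_eq_add_mul eG' n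
  rw [hG, PowerSeries.coeff_rescale, PowerSeries.coeff_mk] at hcoeff
  simp only [coeff_pow_eq_aeval z eR'] at hcoeff
  rw [← hcoeff, hρ, div_pow]
  field_simp

end GammaTriangle

/-! ### Almost positive roots as diagonals of a polygon -/

namespace TypeA

open Finset Dissection

variable {n : ℕ}

theorem simpleRoot_apply (i j : Fin n) : simpleRoot i j = if j = i then 1 else 0 := by
  simp [simpleRoot, Pi.single_apply]

theorem mem_negSimpleRoots {v : Fin n → ℤ} : v ∈ negSimpleRoots n ↔ ∃ i, v = -simpleRoot i := by
  simp [negSimpleRoots, eq_comm]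

theorem neg_simpleRoot_injective : Function.Injective fun i : Fin n => -simpleRoot i := by
  intro i j h
  have h' := congrFun h i
  simp only [Pi.neg_apply, simpleRoot_apply, if_true] at h'
  by_contra hij
  rw [if_neg hij] at h'
  omega

theorem card_negSimpleRoots (n : ℕ) : (negSimpleRoots n).card = n := by
  rw [negSimpleRoots, Finset.card_image_of_injective _ neg_simpleRoot_injective]
  simp

/-- The positive root `α_a + ⋯ + α_b`. -/
def intervalRoot (a b : Fin n) : Fin n → ℤ := fun i => if a ≤ i ∧ i ≤ b then 1 else 0

theorem mem_positiveRoots {v : Fin n → ℤ} :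
    v ∈ positiveRoots n ↔ ∃ a b, a ≤ b ∧ v = intervalRoot a b := by
  have h : ∀ a b : Fin n, ∑ m ∈ Icc a b, simpleRoot m = intervalRoot a b := by
    intro a b
    ext i
    simp [simpleRoot_apply, intervalRoot]
  simp only [positiveRoots, h, mem_image, mem_filter, mem_univ, true_and, Prod.exists]
  constructor
  · rintro ⟨a, b, hab, rfl⟩; exact ⟨a, b, hab, rfl⟩
  · rintro ⟨a, b, hab, rfl⟩; exact ⟨a, b, hab, rfl⟩

/-- The coordinates of a vector, extended by zero. -/
def coord (v : Fin n → ℤ) (i : ℕ) : ℤ := if h : i < n then v ⟨i, h⟩ else 0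

theorem simpleReflection_apply_ne (k : Fin n) (v : Fin n → ℤ) {i : Fin n} (h : i ≠ k) :
    simpleReflection k v i = v i := by
  simp [simpleReflection, simpleRoot_apply, h]

theorem simpleReflection_apply_self (k : Fin n) (v : Fin n → ℤ) : simpleReflection k v k =
    -v k + (if (k : ℕ) = 0 then 0 else coord v (k - 1)) + coord v (k + 1) := by
  have h1 : ∑ j, v j * CartanMatrix.A n j k = ∑ j, (if j = k then 2 * v j else 0) -
      ∑ j : Fin n, (if (j : ℕ) + 1 = k then v j else 0) -
      ∑ j : Fin n, (if (k : ℕ) + 1 = j then v j else 0) := by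
    rw [← Finset.sum_sub_distrib, ← Finset.sum_sub_distrib]
    refine Finset.sum_congr rfl fun j _ => ?_
    simp only [CartanMatrix.A, Matrix.of_apply]
    rcases eq_or_ne j k with rfl | hjk
    · simp; ring
    · have : (j : ℕ) ≠ k := fun h => hjk (Fin.ext h)
      simp only [hjk, if_false]
      split_ifs <;> omega
  have h2 : ∑ j : Fin n, (if (j : ℕ) + 1 = k then v j else 0) =
      if (k : ℕ) = 0 then 0 else coord v (k - 1) := by
    split_ifs with hk
    · exact Finset.sum_eq_zero fun j _ => if_neg (by omega)
    · rw [coord, dif_pos (by omega), Finset.sum_eq_single ⟨(k : ℕ) - 1, by omega⟩]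
      · rw [if_pos]; simp only; omega
      · intro j _ hj
        refine if_neg fun h => hj (Fin.ext ?_)
        simp only; omega
      · simp
  have h3 : ∑ j : Fin n, (if (k : ℕ) + 1 = j then v j else 0) = coord v (k + 1) := by
    rw [coord]
    split_ifs with hk
    · rw [Finset.sum_eq_single ⟨(k : ℕ) + 1, hk⟩]
      · simp
      · intro j _ hj
        exact if_neg fun h => hj (Fin.ext h.symm)
      · simp
    · exact Finset.sum_eq_zero fun j _ => if_neg (by omega)
  simp only [simpleReflection, Pi.sub_apply, Pi.smul_apply, simpleRoot_apply, if_true, h1, h2, h3,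
    Finset.sum_ite_eq', mem_univ, smul_eq_mul]
  ring

theorem coord_intervalRoot (a b : Fin n) (i : ℕ) :
    coord (intervalRoot a b) i = if (a : ℕ) ≤ i ∧ i ≤ b then 1 else 0 := by
  rw [coord]
  split_ifs with h1 h2 h2
  · exact if_pos h2
  · exact if_neg h2
  · omega
  · rfl

/-- Needed so that τ_c-orbits of negative simple roots stay among the almost positive roots. For an
interval root only the position of k relative to the two ends matters: the interval grows, shrinks,
stays, or becomes -α_k. -/
theorem sigma_mem_almostPositiveRoots (k : Fin n) {v : Fin n → ℤ}
    (hv : v ∈ almostPositiveRoots n) : sigma k v ∈ almostPositiveRoots n := by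
  rw [sigma]
  split_ifs with h
  · exact hv
  · rw [almostPositiveRoots, mem_union] at hv ⊢
    have fin_ne : ∀ {i j : Fin n}, i ≠ j ↔ (i : ℕ) ≠ j := fun {i j} => by rw [ne_eq, Fin.ext_iff]
    have key : ∀ w : Fin n → ℤ, (∀ i, i ≠ k → v i = w i) →
        w k = -v k + (if (k : ℕ) = 0 then 0 else coord v (k - 1)) + coord v (k + 1) →
        simpleReflection k v = w := by
      intro w h1 h2
      funext i
      rcases eq_or_ne i k with rfl | hi
      · rw [h2, simpleReflection_apply_self]
      · rw [simpleReflection_apply_ne _ _ hi, h1 i hi]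
    rcases hv with hv | hv
    · have hvk : v = -simpleRoot k := by
        by_contra hne
        exact h ⟨hv, hne⟩
      refine Or.inr (mem_positiveRoots.2 ⟨k, k, le_rfl, key _ ?_ ?_⟩)
      · intro i hi
        rw [hvk, intervalRoot, if_neg (by rw [fin_ne] at hi; simp only [Fin.le_def]; omega)]
        simp [simpleRoot_apply, hi]
      · have h1 : ∀ i : ℕ, i ≠ k → coord v i = 0 := by
          intro i hi
          rw [coord]
          split_ifs with hin
          · rw [hvk]
            simp only [Pi.neg_apply, simpleRoot_apply, neg_eq_zero, ite_eq_right_iff]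
            intro h
            exact absurd (congrArg Fin.val h) hi
          · rfl
        have h2 : (if (k : ℕ) = 0 then 0 else coord v (k - 1)) = 0 := by
          split_ifs with hk
          · rfl
          · exact h1 _ (by omega)
        rw [h2, h1 (k + 1) (by omega), hvk]
        simp [intervalRoot, simpleRoot_apply]
    · obtain ⟨a, b, hab, rfl⟩ := mem_positiveRoots.1 hv
      have hab' : (a : ℕ) ≤ b := hab
      have hb := b.2
      have hk := k.2
      rcases lt_trichotomy ((k : ℕ) + 1) a with hka | hka | hka
      · refine Or.inr (mem_positiveRoots.2 ⟨a, b, hab, key _ (fun i _ => rfl) ?_⟩)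
        simp only [coord_intervalRoot, intervalRoot, Fin.le_def]
        split_ifs <;> omega
      · refine Or.inr (mem_positiveRoots.2 ⟨k, b, by simp only [Fin.le_def]; omega,
          key _ (fun i hi => ?_) ?_⟩)
        · simp only [intervalRoot, Fin.le_def]
          rw [fin_ne] at hi
          split_ifs <;> omega
        · simp only [coord_intervalRoot, intervalRoot, Fin.le_def]
          split_ifs <;> omega
      · rcases lt_trichotomy ((b : ℕ) + 1) k with hkb | hkb | hkb
        · refine Or.inr (mem_positiveRoots.2 ⟨a, b, hab, key _ (fun i _ => rfl) ?_⟩)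
          simp only [coord_intervalRoot, intervalRoot, Fin.le_def]
          split_ifs <;> omega
        · refine Or.inr (mem_positiveRoots.2 ⟨a, k, by simp only [Fin.le_def]; omega,
            key _ (fun i hi => ?_) ?_⟩)
          · simp only [intervalRoot, Fin.le_def]
            rw [fin_ne] at hi
            split_ifs <;> omega
          · simp only [coord_intervalRoot, intervalRoot, Fin.le_def]
            split_ifs <;> omega
        · by_cases hak : (a : ℕ) = k
          · by_cases hbk : (b : ℕ) = k
            · refine Or.inl (mem_negSimpleRoots.2 ⟨k, key _ (fun i hi => ?_) ?_⟩)
              · simp only [intervalRoot, Fin.le_def, Pi.neg_apply, simpleRoot_apply, hi]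
                rw [fin_ne] at hi
                split_ifs <;> omega
              · simp only [coord_intervalRoot, intervalRoot, Fin.le_def, Pi.neg_apply,
                  simpleRoot_apply, if_true]
                split_ifs <;> omega
            · refine Or.inr (mem_positiveRoots.2 ⟨⟨k + 1, by omega⟩, b,
                by simp only [Fin.le_def]; omega, key _ (fun i hi => ?_) ?_⟩)
              · simp only [intervalRoot, Fin.le_def]
                rw [fin_ne] at hi
                split_ifs <;> omega
              · simp only [coord_intervalRoot, intervalRoot, Fin.le_def]
                split_ifs <;> omega
          · by_cases hbk : (b : ℕ) = k
            · refine Or.inr (mem_positiveRoots.2 ⟨a, ⟨k - 1, by omega⟩,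
                by simp only [Fin.le_def]; omega, key _ (fun i hi => ?_) ?_⟩)
              · simp only [intervalRoot, Fin.le_def]
                rw [fin_ne] at hi
                split_ifs <;> omega
              · simp only [coord_intervalRoot, intervalRoot, Fin.le_def]
                split_ifs <;> omega
            · refine Or.inr (mem_positiveRoots.2 ⟨a, b, hab, key _ (fun i _ => rfl) ?_⟩)
              simp only [coord_intervalRoot, intervalRoot, Fin.le_def]
              split_ifs <;> omega

/-! ### Crossing vectors and flips -/

/-- A lattice path defining a triangulation of the polygon with vertices `0, …, n + 2`. -/
structure IsPath (n : ℕ) (y : ℕ → ℤ) : Prop where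
  step : ∀ i, 1 ≤ i → i < n → y i ≤ y (i + 1) ∧ y (i + 1) ≤ y i + 1
  bound : ∀ i, 1 ≤ i → i ≤ n → 0 ≤ y i ∧ y i ≤ i

/-- The vector of crossing numbers of the diagonal `d` with the triangulation given by `y`,
with value `-1` at the diagonals of the triangulation. -/
def crossVec (n : ℕ) (y : ℕ → ℤ) (d : ℤ × ℤ) : Fin n → ℤ := fun i =>
  if d = arc n y (i + 1) then -1 else if Cross d (arc n y (i + 1)) then 1 else 0

theorem crossVec_congr {y y' : ℕ → ℤ} (h : ∀ i, 1 ≤ i → i ≤ n → y i = y' i) (d : ℤ × ℤ) :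
    crossVec n y d = crossVec n y' d := by
  funext i
  have : arc n y (i + 1) = arc n y' (i + 1) := by
    simp only [arc, h (i + 1) (by omega) (by omega)]
  simp only [crossVec, this]

theorem IsPath.le {y : ℕ → ℤ} (hy : IsPath n y) {i j : ℕ} (h1 : 1 ≤ i) (h : i ≤ j) (hj : j ≤ n) :
    y i ≤ y j ∧ y j ≤ y i + (j - i) := by
  induction j, h using Nat.le_induction with
  | base => simp
  | succ j h ih =>
    have := hy.step j (by omega) (by omega)
    have := ih (by omega)
    push_cast
    omega

theorem crossVec_arc {y : ℕ → ℤ} (hy : IsPath n y) (j : Fin n) :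
    crossVec n y (arc n y (j + 1)) = -simpleRoot j := by
  funext i
  rw [Pi.neg_apply, simpleRoot_apply, crossVec]
  rcases eq_or_ne i j with rfl | hij
  · simp
  · have hij' : (i : ℕ) ≠ j := fun h => hij (Fin.ext h)
    rw [if_neg, if_neg, if_neg hij, neg_zero]
    · have hi := i.2
      have hj := j.2
      rcases le_total (i : ℕ) j with h | h
      · have := hy.le (show 1 ≤ (i : ℕ) + 1 by omega) (show (i : ℕ) + 1 ≤ j + 1 by omega) hj
        simp only [Cross, arc]
        push_cast at *
        omega
      · have := hy.le (show 1 ≤ (j : ℕ) + 1 by omega) (show (j : ℕ) + 1 ≤ i + 1 by omega) hi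
        simp only [Cross, arc]
        push_cast at *
        omega
    · intro h
      have := arc_injective n y h
      omega

theorem eq_arc_of_crossVec_eq {y : ℕ → ℤ} {d : ℤ × ℤ} {j : Fin n}
    (h : crossVec n y d = -simpleRoot j) : d = arc n y (j + 1) := by
  have h' := congrFun h j
  rw [Pi.neg_apply, simpleRoot_apply, if_pos rfl, crossVec] at h'
  split_ifs at h' with h1 h2
  exact h1

theorem coord_crossVec (y : ℕ → ℤ) (d : ℤ × ℤ) {i : ℕ} (h : i < n) :
    coord (crossVec n y d) i =
      if d = arc n y (i + 1) then -1 else if Cross d (arc n y (i + 1)) then 1 else 0 := by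
  rw [coord, dif_pos h, crossVec]

/-- The involution `σ_k` corresponds to a flip of the triangulation. -/
theorem sigma_crossVec {y : ℕ → ℤ} (hy : IsPath n y) (k : Fin n)
    (hy' : IsPath n (Function.update y (k + 1) (y (k + 1) - 1)))
    (hprev : 1 ≤ (k : ℕ) → y k = y (k + 1) - 1)
    (hnext : (k : ℕ) + 1 < n → y (k + 2) = y (k + 1))
    {d : ℤ × ℤ} (hd : d ∈ diagonals (Icc 0 ((n : ℤ) + 2))) :
    sigma k (crossVec n y d) =
      crossVec n (Function.update y (k + 1) (y (k + 1) - 1)) d := by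
  set y' := Function.update y (k + 1) (y (k + 1) - 1) with hy'def
  have arc_ne : ∀ i : ℕ, i ≠ k → arc n y' (i + 1) = arc n y (i + 1) := by
    intro i hi
    simp only [arc, hy'def, Function.update_of_ne (show i + 1 ≠ (k : ℕ) + 1 by omega)]
  have arc_k : arc n y' (k + 1) = (y (k + 1) - 1, y (k + 1) + n - k) := by
    simp only [arc, hy'def, Function.update_self, Prod.mk.injEq, true_and]
    push_cast; ring
  have arc_k0 : arc n y (k + 1) = (y (k + 1), y (k + 1) + n + 1 - k) := by
    simp only [arc, Prod.mk.injEq, true_and]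
    push_cast; ring
  rw [sigma]
  split_ifs with h
  · obtain ⟨h1, h2⟩ := h
    obtain ⟨j, hj⟩ := mem_negSimpleRoots.1 h1
    have hjk : (j : ℕ) ≠ k := by
      rintro h
      rw [Fin.ext h] at hj
      exact h2 hj
    have hdj := eq_arc_of_crossVec_eq hj
    rw [hj, hdj, ← arc_ne j hjk, crossVec_arc hy']
  -- In this branch `d` is not an arc of the triangulation, except possibly the one being flipped.
  · have hne : ∀ j : Fin n, j ≠ k → d ≠ arc n y (j + 1) := by
      intro j hj hdj
      refine h ⟨mem_negSimpleRoots.2 ⟨j, by rw [hdj, crossVec_arc hy]⟩, ?_⟩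
      rw [hdj, crossVec_arc hy]
      exact fun e => hj (neg_simpleRoot_injective e)
    funext i
    rcases eq_or_ne i k with rfl | hi
    · rw [simpleReflection_apply_self]
      obtain ⟨p, q⟩ := d
      rw [mem_diagonals_Icc] at hd
      simp only at hd
      have hin := i.2
      have b1 := hy.bound (i + 1) (by omega) (by omega)
      have b2 := hy'.bound (i + 1) (by omega) (by omega)
      rw [hy'def, Function.update_self] at b2
      push_cast at b1
      -- The arc being flipped lies in a quadrilateral two of whose opposite sides are the
      -- neighbouring arcs, or polygon sides at the ends of the path; the other two are always
      -- polygon sides. The reflection formula says that crossings with the two diagonals add up to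
      -- crossings with the two neighbouring sides.
      have eprev : (if (i : ℕ) = 0 then 0 else coord (crossVec n y (p, q)) (i - 1)) =
          if Cross (p, q) (y (i + 1) - 1, y (i + 1) + n + 1 - i) then 1 else 0 := by
        split_ifs with h0 h1 h1
        · simp only [Cross] at h1; omega
        · rfl
        · rw [coord_crossVec _ _ (by omega), if_neg, if_pos]
          · convert h1 using 1
            simp only [arc, show (i : ℕ) - 1 + 1 = i by omega, hprev (by omega)]
            congr 1; ring
          · exact hne ⟨i - 1, by omega⟩ (by simp only [ne_eq, Fin.ext_iff]; omega)
        · rw [coord_crossVec _ _ (by omega), if_neg, if_neg]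
          · convert h1 using 2
            simp only [arc, show (i : ℕ) - 1 + 1 = i by omega, hprev (by omega)]
            congr 1; ring
          · exact hne ⟨i - 1, by omega⟩ (by simp only [ne_eq, Fin.ext_iff]; omega)
      have enext : coord (crossVec n y (p, q)) (i + 1) =
          if Cross (p, q) (y (i + 1), y (i + 1) + n - i) then 1 else 0 := by
        by_cases h0 : (i : ℕ) + 1 < n
        · rw [coord_crossVec _ _ h0, if_neg]
          · have : arc n y (i + 1 + 1) = (y (i + 1), y (i + 1) + n - i) := by
              simp only [arc, add_assoc, Nat.reduceAdd, hnext h0, Prod.mk.injEq, true_and]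
              push_cast; ring
            rw [this]
          · exact hne ⟨i + 1, h0⟩ (by simp only [ne_eq, Fin.ext_iff]; omega)
        · rw [coord, dif_neg h0, if_neg]
          simp only [Cross]; omega
      have nprev : ¬ (1 ≤ (i : ℕ) ∧ p = y (i + 1) - 1 ∧ q = y (i + 1) + n + 1 - i) := by
        rintro ⟨h0, hp, hq⟩
        refine hne ⟨i - 1, by omega⟩ (by simp only [ne_eq, Fin.ext_iff]; omega) ?_
        simp only [arc, show (i : ℕ) - 1 + 1 = i by omega, hprev h0, Prod.mk.injEq]
        omega
      have nnext : ¬ ((i : ℕ) + 1 < n ∧ p = y (i + 1) ∧ q = y (i + 1) + n - i) := by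
        rintro ⟨h0, hp, hq⟩
        refine hne ⟨i + 1, h0⟩ (by simp only [ne_eq, Fin.ext_iff]; omega) ?_
        simp only [arc, add_assoc, Nat.reduceAdd, hnext h0, Prod.mk.injEq]
        push_cast
        omega
      rw [eprev, enext, crossVec, crossVec, arc_k, arc_k0]
      simp only [Cross, Prod.mk.injEq]
      clear eprev enext hne h arc_ne arc_k arc_k0 hprev hnext
      generalize y (i + 1) = a at *
      split_ifs <;> omega
    · rw [simpleReflection_apply_ne _ _ hi]
      simp only [crossVec, arc_ne i (fun h => hi (Fin.ext h))]

end TypeA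

namespace TypeA

open Finset Dissection

variable {n : ℕ}

/-! #### Rotation of diagonals -/

/-- The rotation of the polygon with vertices `0, …, n + 2`. -/
def rot (n : ℕ) (d : ℤ × ℤ) : ℤ × ℤ :=
  if d.2 = n + 2 then (0, d.1 + 1) else (d.1 + 1, d.2 + 1)

theorem rot_mem {d : ℤ × ℤ} (hd : d ∈ diagonals (Icc 0 ((n : ℤ) + 2))) :
    rot n d ∈ diagonals (Icc 0 ((n : ℤ) + 2)) := by
  rw [mem_diagonals_Icc] at *
  rw [rot]
  split_ifs <;> simp only <;> omega

theorem rot_injOn : Set.InjOn (rot n) (diagonals (Icc 0 ((n : ℤ) + 2))) := by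
  rintro ⟨p, q⟩ hd ⟨p', q'⟩ he h
  rw [mem_coe, mem_diagonals_Icc] at *
  simp only [rot] at *
  rw [Prod.mk.injEq]
  split_ifs at h <;> rw [Prod.mk.injEq] at h <;> omega

theorem cross_rot_iff {d e : ℤ × ℤ} (hd : d ∈ diagonals (Icc 0 ((n : ℤ) + 2)))
    (he : e ∈ diagonals (Icc 0 ((n : ℤ) + 2))) : Cross (rot n d) (rot n e) ↔ Cross d e := by
  rw [mem_diagonals_Icc] at *
  simp only [rot, Cross]
  split_ifs <;> simp only <;> omega

/-- Moving the triangulation back by one step is the same as rotating the diagonal forward. The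
bound `hx1` keeps the shifted triangulation inside the polygon. -/
theorem crossVec_rot {x : ℕ → ℤ} (hx : IsPath n x) (hx1 : ∀ i, 1 ≤ i → i ≤ n → 1 ≤ x i)
    {d : ℤ × ℤ} (hd : d ∈ diagonals (Icc 0 ((n : ℤ) + 2))) :
    crossVec n (fun i => x i - 1) d = crossVec n x (rot n d) := by
  funext i
  have h1 := hx1 (i + 1) (by omega) (by omega)
  have h2 := hx.bound (i + 1) (by omega) (by omega)
  have hi := i.2
  obtain ⟨p, q⟩ := d
  rw [mem_diagonals_Icc] at hd
  simp only [crossVec, rot, Cross, arc] at *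
  push_cast at *
  congr 1
  · split_ifs <;> simp only [Prod.mk.injEq, eq_iff_iff] <;> omega
  · congr 1
    split_ifs <;> simp only [eq_iff_iff] <;> omega

theorem rot_iterate_mem {d : ℤ × ℤ} (hd : d ∈ diagonals (Icc 0 ((n : ℤ) + 2))) (m : ℕ) :
    (rot n)^[m] d ∈ diagonals (Icc 0 ((n : ℤ) + 2)) := by
  induction m with
  | zero => exact hd
  | succ m ih => rw [Function.iterate_succ_apply']; exact rot_mem ih

theorem rot_iterate_of_le (m : ℕ) {p q : ℤ} (h : q + m ≤ n + 2) :
    (rot n)^[m] (p, q) = (p + m, q + m) := by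
  induction m with
  | zero => simp
  | succ m ih =>
    push_cast at h
    rw [Function.iterate_succ_apply', ih (by omega), rot, if_neg (by simp only; omega)]
    push_cast
    simp only [Prod.mk.injEq]
    omega

theorem rot_iterate_wrap {p q : ℤ} (hq : q ≤ n + 2) :
    (rot n)^[(n + 2 - q).toNat + 1] (p, q) = (0, p + n + 3 - q) := by
  rw [Function.iterate_succ_apply', rot_iterate_of_le _ (by omega), rot,
    if_pos (by simp only; omega)]
  simp only [Prod.mk.injEq, true_and]
  omega

/-- Diagonals of the same length are related by a rotation. -/
theorem exists_rot_iterate_eq {d e : ℤ × ℤ} (hd : d ∈ diagonals (Icc 0 ((n : ℤ) + 2)))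
    (he : e ∈ diagonals (Icc 0 ((n : ℤ) + 2))) (h : d.2 - d.1 = e.2 - e.1) :
    ∃ m, (rot n)^[m] d = e := by
  obtain ⟨p, q⟩ := d
  obtain ⟨p', q'⟩ := e
  rw [mem_diagonals_Icc] at *
  simp only at *
  -- Rotating once past the last vertex swaps length L for n+3-L; a second pass restores L with left
  -- end 0, and a translation by p' finishes.
  refine ⟨p'.toNat + (((n + 2 - (p + n + 3 - q)).toNat + 1) + ((n + 2 - q).toNat + 1)), ?_⟩
  rw [Function.iterate_add_apply, Function.iterate_add_apply, rot_iterate_wrap (by omega),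
    rot_iterate_wrap (by omega), rot_iterate_of_le _ (by omega), Prod.mk.injEq]
  omega

/-! #### The triangulation attached to a Coxeter element -/

/-- The position of the simple reflection `s_i` in the word of the Coxeter element. -/
def pos (π : Equiv.Perm (Fin n)) (i : ℕ) : ℕ := if h : i < n then π.symm ⟨i, h⟩ else 0

/-- The lattice path of the triangulation attached to a Coxeter element. -/
def coxeterPath (π : Equiv.Perm (Fin n)) : ℕ → ℤ
  | 0 => 0
  | 1 => 1
  | i + 2 => coxeterPath π (i + 1) + if pos π i < pos π (i + 1) then 1 else 0

theorem pos_fin (π : Equiv.Perm (Fin n)) (i : Fin n) : pos π i = π.symm i := by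
  rw [pos, dif_pos i.2]

theorem pos_ne (π : Equiv.Perm (Fin n)) {i j : ℕ} (hi : i < n) (hj : j < n) (h : i ≠ j) :
    pos π i ≠ pos π j := by
  rw [pos, pos, dif_pos hi, dif_pos hj]
  intro e
  have := π.symm.injective (Fin.ext e)
  rw [Fin.mk.injEq] at this
  exact h this

theorem isSlice_coxeterPath (π : Equiv.Perm (Fin n)) : IsSlice (coxeterPath π) := by
  intro i
  cases i with
  | zero => simp [coxeterPath]
  | succ i =>
    rw [coxeterPath]
    split_ifs <;> omega

theorem one_le_coxeterPath (π : Equiv.Perm (Fin n)) (i : ℕ) :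
    1 ≤ coxeterPath π (i + 1) ∧ coxeterPath π (i + 1) ≤ i + 1 := by
  have h := (isSlice_coxeterPath π).le (show 1 ≤ i + 1 by omega)
  have h1 : coxeterPath π 1 = 1 := by simp [coxeterPath]
  push_cast at h
  omega

/-- The lattice paths obtained by flipping the diagonals whose position is at least `m`. -/
def partialPath (π : Equiv.Perm (Fin n)) (m i : ℕ) : ℤ :=
  coxeterPath π i - if m ≤ pos π (i - 1) then 1 else 0

theorem partialPath_succ (π : Equiv.Perm (Fin n)) (m i : ℕ) : partialPath π m (i + 1) =
    coxeterPath π (i + 1) - if m ≤ pos π i then 1 else 0 := rfl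

theorem isPath_partialPath (π : Equiv.Perm (Fin n)) (m : ℕ) : IsPath n (partialPath π m) := by
  constructor
  · intro i h1 h2
    obtain ⟨i, rfl⟩ : ∃ j, i = j + 1 := ⟨i - 1, by omega⟩
    rw [partialPath_succ, partialPath_succ, coxeterPath]
    split_ifs <;> omega
  · intro i h1 h2
    obtain ⟨i, rfl⟩ : ∃ j, i = j + 1 := ⟨i - 1, by omega⟩
    have := one_le_coxeterPath π i
    rw [partialPath_succ]
    push_cast
    split_ifs <;> omega

/-- When π k is flipped, exactly the arcs of later position have been lowered. The steps of
`coxeterPath` are chosen so that, in either order of two neighbours, this puts arc π k in the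
position required by `sigma_crossVec`. -/
theorem sigma_partialPath (π : Equiv.Perm (Fin n)) (k : Fin n) {d : ℤ × ℤ}
    (hd : d ∈ diagonals (Icc 0 ((n : ℤ) + 2))) :
    sigma (π k) (crossVec n (partialPath π (k + 1)) d) = crossVec n (partialPath π k) d := by
  have hpos : pos π (π k) = k := by rw [pos_fin, Equiv.symm_apply_apply]
  have hk := (π k).2
  have heq : ∀ i, 1 ≤ i → i ≤ n → partialPath π k i =
      Function.update (partialPath π (k + 1)) (π k + 1) (partialPath π (k + 1) (π k + 1) - 1) i := by
    intro i h1 h2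
    obtain ⟨i, rfl⟩ : ∃ j, i = j + 1 := ⟨i - 1, by omega⟩
    by_cases hi : i = π k
    · rw [hi, Function.update_self, partialPath_succ, partialPath_succ, hpos, if_pos le_rfl,
        if_neg (by omega)]
      ring
    · rw [Function.update_of_ne (by omega), partialPath_succ, partialPath_succ]
      have := pos_ne π (show i < n by omega) hk hi
      rw [hpos] at this
      split_ifs <;> omega
  rw [crossVec_congr heq]
  refine sigma_crossVec (isPath_partialPath π _) (π k) ?_ ?_ ?_ hd
  · have := isPath_partialPath π k
    constructor
    · intro i h1 h2
      rw [← heq i h1 (by omega), ← heq (i + 1) (by omega) (by omega)]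
      exact this.step i h1 h2
    · intro i h1 h2
      rw [← heq i h1 h2]
      exact this.bound i h1 h2
  · intro h1
    obtain ⟨j, hj⟩ : ∃ j, (π k : ℕ) = j + 1 := ⟨π k - 1, by omega⟩
    have := pos_ne π (show j < n by omega) hk (by omega)
    rw [hpos] at this
    rw [hj] at hpos ⊢
    rw [partialPath_succ, partialPath_succ, coxeterPath, hpos]
    split_ifs <;> omega
  · intro h1
    have := pos_ne π h1 hk (by omega)
    rw [show (π k : ℕ) + 2 = π k + 1 + 1 from rfl, partialPath_succ, partialPath_succ,
      coxeterPath, hpos]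
    rw [hpos] at this
    split_ifs <;> omega

theorem foldr_comp_ofFn {α : Type*} {n : ℕ} (g : Fin n → α → α) (P : ℕ → α)
    (h : ∀ k : Fin n, g k (P (k + 1)) = P k) :
    (List.ofFn g).foldr (· ∘ ·) id (P n) = P 0 := by
  induction n generalizing P with
  | zero => simp
  | succ n ih =>
    have := ih (fun k => g k.succ) (fun m => P (m + 1)) fun k => h k.succ
    rw [List.ofFn_succ, List.foldr_cons, Function.comp_apply, this]
    exact h 0

/-- The root vector of a diagonal. -/
def rootOf (π : Equiv.Perm (Fin n)) (d : ℤ × ℤ) : Fin n → ℤ := crossVec n (coxeterPath π) d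

theorem isPath_coxeterPath (π : Equiv.Perm (Fin n)) : IsPath n (coxeterPath π) := by
  constructor
  · intro i _ _
    exact isSlice_coxeterPath π i
  · intro i h1 h2
    obtain ⟨i, rfl⟩ : ∃ j, i = j + 1 := ⟨i - 1, by omega⟩
    have := one_le_coxeterPath π i
    push_cast
    omega

/-- The last reflection of the word acts first, so the paths run from `partialPath π n`, which is
the original one, down to `partialPath π 0`, where every arc is lowered by 1. -/
theorem tau_rootOf (π : Equiv.Perm (Fin n)) {d : ℤ × ℤ}
    (hd : d ∈ diagonals (Icc 0 ((n : ℤ) + 2))) : tau π (rootOf π d) = rootOf π (rot n d) := by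
  have h := foldr_comp_ofFn (fun k => sigma (π k)) (fun m => crossVec n (partialPath π m) d)
    fun k => sigma_partialPath π k hd
  have hn : crossVec n (partialPath π n) d = rootOf π d := by
    refine crossVec_congr (fun i h1 h2 => ?_) d
    rw [partialPath, if_neg, sub_zero]
    rw [pos, dif_pos (by omega)]
    exact not_le.2 (Fin.is_lt _)
  have h0 : crossVec n (partialPath π 0) d = rootOf π (rot n d) := by
    rw [rootOf, ← crossVec_rot (isPath_coxeterPath π) _ hd]
    · refine crossVec_congr (fun i h1 h2 => ?_) d
      rw [partialPath, if_pos (Nat.zero_le _)]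
    · intro i h1 h2
      obtain ⟨i, rfl⟩ : ∃ j, i = j + 1 := ⟨i - 1, by omega⟩
      exact (one_le_coxeterPath π i).1
  rw [← hn, ← h0]
  exact h

theorem tau_iterate_rootOf (π : Equiv.Perm (Fin n)) {d : ℤ × ℤ}
    (hd : d ∈ diagonals (Icc 0 ((n : ℤ) + 2))) (m : ℕ) :
    (tau π)^[m] (rootOf π d) = rootOf π ((rot n)^[m] d) := by
  induction m with
  | zero => rfl
  | succ m ih =>
    rw [Function.iterate_succ_apply', Function.iterate_succ_apply', ih,
      tau_rootOf π (rot_iterate_mem hd m)]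

/-- The diagonal corresponding to `-α_i`. -/
def initialDiagonal (π : Equiv.Perm (Fin n)) (i : Fin n) : ℤ × ℤ := arc n (coxeterPath π) (i + 1)

theorem initialDiagonal_mem (π : Equiv.Perm (Fin n)) (i : Fin n) :
    initialDiagonal π i ∈ diagonals (Icc 0 ((n : ℤ) + 2)) := by
  have := arc_mem_diagonals (isSlice_coxeterPath π) (show 1 ≤ (i : ℕ) + 1 by omega) i.2
  rwa [coxeterPath, zero_add] at this

theorem rootOf_initialDiagonal (π : Equiv.Perm (Fin n)) (i : Fin n) :
    rootOf π (initialDiagonal π i) = -simpleRoot i :=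
  crossVec_arc (isPath_coxeterPath π) i

theorem rootOf_eq_neg_simpleRoot_iff (π : Equiv.Perm (Fin n)) {d : ℤ × ℤ} {i : Fin n} :
    rootOf π d = -simpleRoot i ↔ d = initialDiagonal π i :=
  ⟨eq_arc_of_crossVec_eq, fun h => h ▸ rootOf_initialDiagonal π i⟩

/-- Every diagonal has the length of an initial diagonal. -/
theorem exists_initialDiagonal (π : Equiv.Perm (Fin n)) {d : ℤ × ℤ}
    (hd : d ∈ diagonals (Icc 0 ((n : ℤ) + 2))) :
    ∃ i, (initialDiagonal π i).2 - (initialDiagonal π i).1 = d.2 - d.1 := by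
  rw [mem_diagonals_Icc] at hd
  refine ⟨⟨(n + 1 - (d.2 - d.1)).toNat, by omega⟩, ?_⟩
  simp only [initialDiagonal, arc]
  push_cast
  omega

/-! ### The bijection between diagonals and almost positive roots -/

theorem rot_iterate_injOn (m : ℕ) :
    Set.InjOn (rot n)^[m] (diagonals (Icc 0 ((n : ℤ) + 2))) := by
  induction m with
  | zero => exact Function.injective_id.injOn
  | succ m ih =>
    intro d hd e he h
    rw [Function.iterate_succ_apply', Function.iterate_succ_apply'] at h
    exact ih hd he (rot_injOn (rot_iterate_mem hd m) (rot_iterate_mem he m) h)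

theorem cross_rot_iterate_iff {d e : ℤ × ℤ} (hd : d ∈ diagonals (Icc 0 ((n : ℤ) + 2)))
    (he : e ∈ diagonals (Icc 0 ((n : ℤ) + 2))) (m : ℕ) :
    Cross ((rot n)^[m] d) ((rot n)^[m] e) ↔ Cross d e := by
  induction m with
  | zero => rfl
  | succ m ih =>
    rw [Function.iterate_succ_apply', Function.iterate_succ_apply',
      cross_rot_iff (rot_iterate_mem hd m) (rot_iterate_mem he m), ih]

/-- A rotation moves the first diagonal into the triangulation, where the vector is some -α_i and
determines the diagonal; rotations are injective. -/
theorem rootOf_injOn (π : Equiv.Perm (Fin n)) :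
    Set.InjOn (rootOf π) (diagonals (Icc 0 ((n : ℤ) + 2))) := by
  intro d hd e he h
  obtain ⟨i, hi⟩ := exists_initialDiagonal π hd
  obtain ⟨m, hm⟩ := exists_rot_iterate_eq hd (initialDiagonal_mem π i) hi.symm
  have h1 := tau_iterate_rootOf π hd m
  rw [h, tau_iterate_rootOf π he m, hm, rootOf_initialDiagonal, rootOf_eq_neg_simpleRoot_iff,
    ← hm] at h1
  exact (rot_iterate_injOn m he hd h1).symm

theorem tau_mem_almostPositiveRoots (π : Equiv.Perm (Fin n)) {v : Fin n → ℤ}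
    (hv : v ∈ almostPositiveRoots n) : tau π v ∈ almostPositiveRoots n := by
  have : ∀ l : List (Fin n), (l.map sigma).foldr (· ∘ ·) id v ∈ almostPositiveRoots n := by
    intro l
    induction l with
    | nil => exact hv
    | cons k l ih => exact sigma_mem_almostPositiveRoots k ih
  have h := this (List.ofFn π)
  rw [List.map_ofFn] at h
  exact h

theorem rootOf_mem_almostPositiveRoots (π : Equiv.Perm (Fin n)) {d : ℤ × ℤ}
    (hd : d ∈ diagonals (Icc 0 ((n : ℤ) + 2))) : rootOf π d ∈ almostPositiveRoots n := by
  obtain ⟨i, hi⟩ := exists_initialDiagonal π hd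
  obtain ⟨m, hm⟩ := exists_rot_iterate_eq (initialDiagonal_mem π i) hd hi
  rw [← hm, ← tau_iterate_rootOf π (initialDiagonal_mem π i), rootOf_initialDiagonal]
  clear hm
  induction m with
  | zero => exact mem_union_left _ (mem_negSimpleRoots.2 ⟨i, rfl⟩)
  | succ m ih =>
    rw [Function.iterate_succ_apply']
    exact tau_mem_almostPositiveRoots π ih

/-- Any injection will do: together with the injectivity of `rootOf` this count forces its
surjectivity. -/
theorem card_almostPositiveRoots_le (n : ℕ) :
    (almostPositiveRoots n).card ≤ (diagonals (Icc 0 ((n : ℤ) + 2))).card := by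
  have h1 : (almostPositiveRoots n).card ≤ (Finset.univ : Finset (Fin n)).card +
      ((Finset.univ : Finset (Fin n × Fin n)).filter fun p => p.1 ≤ p.2).card :=
    (card_union_le _ _).trans (add_le_add card_image_le card_image_le)
  refine h1.trans ?_
  rw [← Finset.card_disjSum]
  refine Finset.card_le_card_of_injOn
    (Sum.elim (fun i : Fin n => ((i : ℤ) + 1, (n : ℤ) + 2))
      (fun p : Fin n × Fin n => ((p.1 : ℤ), (p.2 : ℤ) + 2))) ?_ ?_
  · rintro (i | ⟨a, b⟩) h
    · rw [mem_coe, mem_diagonals_Icc]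
      simp only [Sum.elim_inl]
      omega
    · rw [mem_coe, inr_mem_disjSum, mem_filter, Fin.le_def] at h
      rw [mem_coe, mem_diagonals_Icc]
      simp only [Sum.elim_inr] at h ⊢
      omega
  · rintro (i | ⟨a, b⟩) h (i' | ⟨a', b'⟩) h' e
    · simp only [Sum.elim_inl, Prod.mk.injEq] at e
      rw [Sum.inl.injEq, Fin.ext_iff]
      omega
    · simp only [Sum.elim_inl, Sum.elim_inr, Prod.mk.injEq] at e
      omega
    · simp only [Sum.elim_inl, Sum.elim_inr, Prod.mk.injEq] at e
      omega
    · simp only [Sum.elim_inr, Prod.mk.injEq] at e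
      rw [Sum.inr.injEq, Prod.mk.injEq, Fin.ext_iff, Fin.ext_iff]
      omega

theorem image_rootOf (π : Equiv.Perm (Fin n)) :
    (diagonals (Icc 0 ((n : ℤ) + 2))).image (rootOf π) = almostPositiveRoots n := by
  refine Finset.eq_of_subset_of_card_le (fun v hv => ?_) ?_
  · obtain ⟨d, hd, rfl⟩ := mem_image.1 hv
    exact rootOf_mem_almostPositiveRoots π hd
  · rw [card_image_of_injOn (rootOf_injOn π)]
    exact card_almostPositiveRoots_le n

/-- Compatible roots are noncrossing diagonals. -/
theorem compatible_rootOf_iff (π : Equiv.Perm (Fin n)) {d e : ℤ × ℤ}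
    (hd : d ∈ diagonals (Icc 0 ((n : ℤ) + 2))) (he : e ∈ diagonals (Icc 0 ((n : ℤ) + 2))) :
    Compatible π (rootOf π d) (rootOf π e) ↔ ¬ Cross d e := by
  have key : ∀ (m : ℕ) (i : Fin n), (rot n)^[m] d = initialDiagonal π i →
      (rootOf π ((rot n)^[m] e) i ≤ 0 ↔ ¬ Cross d e) := by
    intro m i h
    rw [← cross_rot_iterate_iff hd he m, h, rootOf, crossVec]
    have hs : Cross (initialDiagonal π i) ((rot n)^[m] e) ↔
        Cross ((rot n)^[m] e) (arc n (coxeterPath π) (i + 1)) :=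
      ⟨fun h => h.symm, fun h => h.symm⟩
    rw [hs]
    split_ifs with h1 h2
    · rw [h1]; simp [Cross]
    · simpa using h2
    · simpa using h2
  constructor
  · rintro ⟨m, i, h1, h2⟩
    rw [tau_iterate_rootOf π hd, rootOf_eq_neg_simpleRoot_iff] at h1
    rw [tau_iterate_rootOf π he] at h2
    exact (key m i h1).1 h2
  · intro h
    obtain ⟨i, hi⟩ := exists_initialDiagonal π hd
    obtain ⟨m, hm⟩ := exists_rot_iterate_eq hd (initialDiagonal_mem π i) hi.symm
    refine ⟨m, i, ?_, ?_⟩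
    · rw [tau_iterate_rootOf π hd, hm, rootOf_initialDiagonal]
    · rw [tau_iterate_rootOf π he]
      exact (key m i hm).2 h

end TypeA

/-! ### The `F`-triangle of the cluster complex -/

/-- The bound `h` ensures that truncating the first exponent at |T| loses no face; for the second
exponent this is automatic. -/
theorem FinComplex.aeval_fTriangle {V K : Type*} [DecidableEq V] [CommRing K] [Algebra ℤ K]
    (C : FinComplex V)
    (T : Finset V) (h : ∀ F ∈ C.faces, (F \ T).card ≤ T.card) (a b : K) :
    MvPolynomial.aeval ![a, b] (C.fTriangle T) =
      ∑ F ∈ C.faces, a ^ (F \ T).card * b ^ (F ∩ T).card := by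
  rw [← Finset.sum_fiberwise_of_maps_to
    (t := Finset.range (T.card + 1) ×ˢ Finset.range (T.card + 1))
    (g := fun F => ((F \ T).card, (F ∩ T).card)), Finset.sum_product, FinComplex.fTriangle, map_sum]
  · refine Finset.sum_congr rfl fun i _ => ?_
    rw [map_sum]
    refine Finset.sum_congr rfl fun j _ => ?_
    rw [Finset.sum_congr rfl (g := fun _ => a ^ i * b ^ j)]
    · simp [FinComplex.fNumber, mul_assoc]
    · intro F hF
      have := (Finset.mem_filter.1 hF).2
      rw [Prod.mk.injEq] at this
      rw [this.1, this.2]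
  · intro F hF
    have h1 := h F hF
    have h2 := Finset.card_le_card (Finset.inter_subset_right : F ∩ T ⊆ T)
    simp only [Finset.mem_product, Finset.mem_range]
    omega

namespace TypeA

open Finset Dissection

variable {n : ℕ}

theorem mem_faces_clusterComplex (π : Equiv.Perm (Fin n)) {F : Finset (Fin n → ℤ)} :
    F ∈ (clusterComplex π).faces ↔ F ⊆ almostPositiveRoots n ∧
      ∀ α ∈ F, ∀ β ∈ F, α ≠ β → Compatible π α β := by
  simp [clusterComplex]

theorem mem_image_rootOf_iff (π : Equiv.Perm (Fin n)) {D : Finset (ℤ × ℤ)} {d : ℤ × ℤ}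
    (hD : ∀ d ∈ D, d ∈ diagonals (Icc 0 ((n : ℤ) + 2)))
    (hd : d ∈ diagonals (Icc 0 ((n : ℤ) + 2))) : rootOf π d ∈ D.image (rootOf π) ↔ d ∈ D := by
  constructor
  · intro h
    obtain ⟨e, he, h⟩ := mem_image.1 h
    exact rootOf_injOn π (hD e he) hd h ▸ he
  · exact fun h => mem_image_of_mem _ h

theorem image_rootOf_mem_faces (π : Equiv.Perm (Fin n)) {D : Finset (ℤ × ℤ)}
    (hD : D ∈ dissections (Icc 0 ((n : ℤ) + 2))) :
    D.image (rootOf π) ∈ (clusterComplex π).faces := by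
  rw [mem_dissections] at hD
  rw [mem_faces_clusterComplex]
  refine ⟨fun v hv => ?_, fun v hv w hw _ => ?_⟩
  · obtain ⟨d, hd, rfl⟩ := mem_image.1 hv
    exact rootOf_mem_almostPositiveRoots π (hD.1 d hd)
  · obtain ⟨d, hd, rfl⟩ := mem_image.1 hv
    obtain ⟨e, he, rfl⟩ := mem_image.1 hw
    rw [compatible_rootOf_iff π (hD.1 d hd) (hD.1 e he)]
    exact hD.2 d hd e he

theorem exists_dissection_of_mem_faces (π : Equiv.Perm (Fin n)) {F : Finset (Fin n → ℤ)}
    (hF : F ∈ (clusterComplex π).faces) :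
    ∃ D ∈ dissections (Icc 0 ((n : ℤ) + 2)), D.image (rootOf π) = F := by
  rw [mem_faces_clusterComplex, ← image_rootOf π] at hF
  refine ⟨(diagonals (Icc 0 ((n : ℤ) + 2))).filter fun d => rootOf π d ∈ F, ?_, ?_⟩
  · rw [mem_dissections]
    refine ⟨fun d hd => (mem_filter.1 hd).1, fun d hd e he => ?_⟩
    rw [mem_filter] at hd he
    rcases eq_or_ne d e with rfl | hde
    · simp [Cross]
    · rw [← compatible_rootOf_iff π hd.1 he.1]
      exact hF.2 _ hd.2 _ he.2 fun h => hde (rootOf_injOn π hd.1 he.1 h)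
  · ext v
    simp only [mem_image, mem_filter]
    constructor
    · rintro ⟨d, hd, rfl⟩
      exact hd.2
    · intro hv
      obtain ⟨d, hd, rfl⟩ := mem_image.1 (hF.1 hv)
      exact ⟨d, ⟨hd, hv⟩, rfl⟩

theorem rootOf_mem_negSimpleRoots_iff (π : Equiv.Perm (Fin n)) {d : ℤ × ℤ} :
    rootOf π d ∈ negSimpleRoots n ↔ ∃ i, 1 ≤ i ∧ i ≤ n ∧ d = arc n (coxeterPath π) i := by
  rw [mem_negSimpleRoots]
  constructor
  · rintro ⟨i, hi⟩
    exact ⟨i + 1, by omega, i.2, (rootOf_eq_neg_simpleRoot_iff π).1 hi⟩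
  · rintro ⟨i, h1, h2, h⟩
    refine ⟨⟨i - 1, by omega⟩, (rootOf_eq_neg_simpleRoot_iff π).2 ?_⟩
    rw [h, initialDiagonal]
    simp only [Nat.sub_add_cancel h1]

theorem card_image_rootOf (π : Equiv.Perm (Fin n)) {D : Finset (ℤ × ℤ)}
    (hD : ∀ d ∈ D, d ∈ diagonals (Icc 0 ((n : ℤ) + 2))) : (D.image (rootOf π)).card = D.card :=
  card_image_of_injOn fun _ hd _ he h => rootOf_injOn π (hD _ hd) (hD _ he) h

/-- By shape independence, the Coxeter triangulation may be replaced by the fan defining `triangle`.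
-/
theorem sum_faces_clusterComplex {K : Type*} [CommRing K] (π : Equiv.Perm (Fin n)) (a b : K) :
    ∑ F ∈ (clusterComplex π).faces,
      a ^ (F \ negSimpleRoots n).card * b ^ (F ∩ negSimpleRoots n).card = triangle a b n := by
  rw [triangle, ← triangleSum_eq_fan a b n (isSlice_coxeterPath π), triangleSum]
  have h0 : coxeterPath π 0 = 0 := by simp [coxeterPath]
  rw [h0, zero_add, dsum]
  symm
  refine Finset.sum_bij (fun D _ => D.image (rootOf π)) ?_ ?_ ?_ ?_
  · exact fun D hD => image_rootOf_mem_faces π hD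
  · intro D hD E hE h
    have hD := (mem_dissections.1 hD).1
    have hE := (mem_dissections.1 hE).1
    ext d
    constructor
    · intro hd
      rw [← mem_image_rootOf_iff π hE (hD d hd), ← h]
      exact mem_image_of_mem _ hd
    · intro hd
      rw [← mem_image_rootOf_iff π hD (hE d hd), h]
      exact mem_image_of_mem _ hd
  · intro F hF
    obtain ⟨D, hD, h⟩ := exists_dissection_of_mem_faces π hF
    exact ⟨D, hD, h⟩
  · intro D hD
    have hD := (mem_dissections.1 hD).1
    have e1 : D.image (rootOf π) ∩ negSimpleRoots n =
        (D.filter fun d => rootOf π d ∈ negSimpleRoots n).image (rootOf π) := by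
      ext v
      simp only [mem_inter, mem_image, mem_filter]
      constructor
      · rintro ⟨⟨d, hd, rfl⟩, h⟩
        exact ⟨d, ⟨hd, h⟩, rfl⟩
      · rintro ⟨d, ⟨hd, h⟩, rfl⟩
        exact ⟨⟨d, hd, rfl⟩, h⟩
    have e2 : D.image (rootOf π) \ negSimpleRoots n =
        (D.filter fun d => ¬ rootOf π d ∈ negSimpleRoots n).image (rootOf π) := by
      ext v
      simp only [mem_sdiff, mem_image, mem_filter]
      constructor
      · rintro ⟨⟨d, hd, rfl⟩, h⟩
        exact ⟨d, ⟨hd, h⟩, rfl⟩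
      · rintro ⟨d, ⟨hd, h⟩, rfl⟩
        exact ⟨⟨d, hd, rfl⟩, h⟩
    rw [e1, e2, card_image_rootOf π fun d hd => hD d (mem_filter.1 hd).1,
      card_image_rootOf π fun d hd => hD d (mem_filter.1 hd).1]
    have e3 : ∀ d, arcWeight a b n (coxeterPath π) 1 d =
        if rootOf π d ∈ negSimpleRoots n then b else a := by
      intro d
      rw [arcWeight]
      congr 1
      exact propext (rootOf_mem_negSimpleRoots_iff π).symm
    simp only [e3]
    rw [Finset.prod_ite, prod_const, prod_const, mul_comm]

theorem card_sdiff_le_of_mem_faces (π : Equiv.Perm (Fin n)) {F : Finset (Fin n → ℤ)}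
    (hF : F ∈ (clusterComplex π).faces) :
    (F \ negSimpleRoots n).card ≤ (negSimpleRoots n).card := by
  obtain ⟨D, hD, rfl⟩ := exists_dissection_of_mem_faces π hF
  rw [card_negSimpleRoots]
  exact (card_le_card sdiff_subset).trans (card_image_le.trans (card_le_of_mem_dissections hD))

theorem aeval_fTriangle_clusterComplex {K : Type*} [CommRing K] [Algebra ℤ K]
    (π : Equiv.Perm (Fin n)) (a b : K) :
    MvPolynomial.aeval ![a, b] ((clusterComplex π).fTriangle (negSimpleRoots n)) =
      triangle a b n := by
  rw [FinComplex.aeval_fTriangle _ _ fun F hF => card_sdiff_le_of_mem_faces π hF,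
    sum_faces_clusterComplex]

end TypeA

/-! ### The `Γ`-triangle of the cluster complex -/

namespace GammaTriangle

open Polynomial

theorem ratX_eq : ratX = algebraMap (MvPolynomial (Fin 2) ℤ) RatXY (MvPolynomial.X 0) := rfl

theorem one_sub_ratX_ne_zero : (1 : RatXY) - ratX ≠ 0 := by
  rw [ratX_eq, ← map_one (algebraMap (MvPolynomial (Fin 2) ℤ) RatXY), ← map_sub, Ne,
    FaithfulSMul.algebraMap_eq_zero_iff]
  intro h
  simpa using congrArg (MvPolynomial.eval fun _ => (0 : ℤ)) h

theorem one_add_ratX_ne_zero : (1 : RatXY) + ratX ≠ 0 := by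
  rw [ratX_eq, ← map_one (algebraMap (MvPolynomial (Fin 2) ℤ) RatXY), ← map_add, Ne,
    FaithfulSMul.algebraMap_eq_zero_iff]
  intro h
  simpa using congrArg (MvPolynomial.eval fun _ => (0 : ℤ)) h

/-- The coefficients of the `Γ`-triangle of type `A_n`. -/
def gammaCoeff (n i j : ℕ) : ℤ := if j ≤ n then (powCoeff (j + 1) (n - j)).coeff i else 0

theorem gammaCoeff_eq_zero {n i j : ℕ} (h : n < j + 2 * i) : gammaCoeff n i j = 0 := by
  rw [gammaCoeff]
  split_ifs with hj
  · exact coeff_powCoeff_of_lt _ (by omega)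
  · rfl

theorem aeval_powCoeff_eq_sum {K : Type*} [Field K] (z : K) {n j : ℕ} (hj : j ≤ n) :
    aeval z (powCoeff (j + 1) (n - j)) =
      ∑ i ∈ Finset.range (n + 1), (gammaCoeff n i j : K) * z ^ i := by
  have hdeg : (powCoeff (j + 1) (n - j)).natDegree < n + 1 := by
    rw [Nat.lt_succ_iff, natDegree_le_iff_coeff_eq_zero]
    exact fun k hk => coeff_powCoeff_of_lt _ (by omega)
  rw [aeval_eq_sum_range' hdeg]
  refine Finset.sum_congr rfl fun i _ => ?_
  rw [gammaCoeff, if_pos hj, zsmul_eq_mul]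

theorem isGammaTriangle_gammaCoeff {n : ℕ} (π : Equiv.Perm (Fin n)) :
    (TypeA.clusterComplex π).IsGammaTriangle (TypeA.negSimpleRoots n) (gammaCoeff n) := by
  rw [FinComplex.IsGammaTriangle, FinComplex.hTriangle, TypeA.card_negSimpleRoots,
    TypeA.aeval_fTriangle_clusterComplex,
    triangle_eq_sum_powCoeff _ one_sub_ratX_ne_zero one_add_ratX_ne_zero, Finset.sum_comm]
  refine ⟨fun i j h => gammaCoeff_eq_zero h, ?_⟩
  congr 1
  refine Finset.sum_congr rfl fun j hj => ?_
  rw [Finset.mem_range] at hj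
  rw [aeval_powCoeff_eq_sum _ (by omega), Finset.mul_sum]
  refine Finset.sum_congr rfl fun i _ => ?_
  ring

/-- The function x/(1+x)^2 takes equal values at a and b only if a = b or ab = 1; the shift by 2
excludes the latter. -/
theorem injective_div_sq : Function.Injective fun m : ℕ => ((m : ℚ) + 2) / (1 + (m + 2)) ^ 2 := by
  intro a b h
  have ha : (0 : ℚ) ≤ a := Nat.cast_nonneg a
  have hb : (0 : ℚ) ≤ b := Nat.cast_nonneg b
  simp only at h
  rw [div_eq_div_iff (by positivity) (by positivity)] at h
  have h' : ((a : ℚ) - b) * (1 - (a + 2) * (b + 2)) = 0 := by linear_combination h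
  rcases mul_eq_zero.1 h' with h'' | h''
  · exact_mod_cast sub_eq_zero.1 h''
  · nlinarith

/-- The monomials in `x / (1 + x) ^ 2` and `(1 + x y) / (1 + x)` are linearly independent. -/
theorem eq_zero_of_sum_eq_zero {n : ℕ} {δ : ℕ → ℕ → ℤ} (hδ : ∀ i j, n < j + 2 * i → δ i j = 0)
    (h : (1 + ratX) ^ n * ∑ i ∈ Finset.range (n + 1), ∑ j ∈ Finset.range (n + 1),
      (δ i j : RatXY) * (ratX / (1 + ratX) ^ 2) ^ i * ((1 + ratX * ratY) / (1 + ratX)) ^ j = 0)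
    (i j : ℕ) : δ i j = 0 := by
  -- Denominators are cleared termwise. Truncated subtraction in the exponent is harmless, since δ
  -- vanishes where it would occur.
  have hterm : ∀ {K : Type} [Field K] (x y : K), 1 + x ≠ 0 → ∀ i j,
      (1 + x) ^ n * ((δ i j : K) * (x / (1 + x) ^ 2) ^ i * ((1 + x * y) / (1 + x)) ^ j) =
        δ i j * x ^ i * (1 + x) ^ (n - 2 * i - j) * (1 + x * y) ^ j := by
    intro K _ x y hx i j
    by_cases hij : n < j + 2 * i
    · simp [hδ i j hij]
    · have : (1 + x) ^ n = (1 + x) ^ (n - 2 * i - j) * ((1 + x) ^ 2) ^ i * (1 + x) ^ j := by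
        rw [← pow_mul, ← pow_add, ← pow_add]
        congr 1
        omega
      rw [this, div_pow, div_pow]
      field_simp
  set p : MvPolynomial (Fin 2) ℤ := ∑ i ∈ Finset.range (n + 1), ∑ j ∈ Finset.range (n + 1),
    (δ i j : MvPolynomial (Fin 2) ℤ) * MvPolynomial.X 0 ^ i *
      (1 + MvPolynomial.X 0) ^ (n - 2 * i - j) *
      (1 + MvPolynomial.X 0 * MvPolynomial.X 1) ^ j with hp
  have hp0 : p = 0 := by
    rw [← FaithfulSMul.algebraMap_eq_zero_iff _ RatXY, ← h, hp, Finset.mul_sum, map_sum]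
    refine Finset.sum_congr rfl fun i _ => ?_
    rw [Finset.mul_sum, map_sum]
    refine Finset.sum_congr rfl fun j _ => ?_
    rw [hterm ratX ratY one_add_ratX_ne_zero]
    simp [ratX, ratY]
  have heval : ∀ x w : ℚ, x ≠ 0 → 1 + x ≠ 0 → ∑ i ∈ Finset.range (n + 1),
      ∑ j ∈ Finset.range (n + 1), (δ i j : ℚ) * (x / (1 + x) ^ 2) ^ i * w ^ j = 0 := by
    intro x w hx hx1
    -- For fixed x ≠ 0, this choice of y makes (1+xy)/(1+x) an arbitrary w, so the two quantities
    -- vary independently.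
    have hy : w = (1 + x * ((w * (1 + x) - 1) / x)) / (1 + x) := by field_simp; ring
    have h1 : MvPolynomial.aeval ![x, (w * (1 + x) - 1) / x] p = 0 := by rw [hp0, map_zero]
    rw [← mul_eq_zero_iff_left (pow_ne_zero n hx1), ← h1, hp, Finset.mul_sum, map_sum]
    refine Finset.sum_congr rfl fun i _ => ?_
    rw [Finset.mul_sum, map_sum]
    refine Finset.sum_congr rfl fun j _ => ?_
    conv_lhs => rw [hy]
    rw [hterm x _ hx1]
    simp
  have hcol : ∀ j < n + 1, ∀ x : ℚ, x ≠ 0 → 1 + x ≠ 0 →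
      ∑ i ∈ Finset.range (n + 1), (δ i j : ℚ) * (x / (1 + x) ^ 2) ^ i = 0 := by
    intro j hj x hx hx1
    -- For fixed x the sum is a polynomial in w that vanishes everywhere, so each coefficient is 0.
    have hq : (∑ j ∈ Finset.range (n + 1), Polynomial.C (∑ i ∈ Finset.range (n + 1),
        (δ i j : ℚ) * (x / (1 + x) ^ 2) ^ i) * X ^ j : ℚ[X]) = 0 := by
      refine Polynomial.funext fun w => ?_
      rw [eval_zero, ← heval x w hx hx1, Finset.sum_comm, eval_finsetSum]
      refine Finset.sum_congr rfl fun j _ => ?_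
      rw [eval_mul, eval_C, eval_pow, eval_X, Finset.sum_mul]
    have := congrArg (fun q => coeff q j) hq
    simp only [finsetSum_coeff, coeff_C_mul, coeff_X_pow, coeff_zero, mul_ite, mul_one,
      mul_zero, Finset.sum_ite_eq, Finset.mem_range, hj, if_true] at this
    exact this
  by_cases hij : n < j + 2 * i
  · exact hδ i j hij
  · have hq : (∑ i ∈ Finset.range (n + 1), Polynomial.C (δ i j : ℚ) * X ^ i : ℚ[X]) = 0 := by
      -- The values of x/(1+x)^2 at x = m+2 are infinitely many roots.
      refine eq_zero_of_infinite_isRoot _ (Set.infinite_of_injective_forall_mem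
        injective_div_sq fun m => ?_)
      have hm : (0 : ℚ) ≤ m := Nat.cast_nonneg m
      have := hcol j (by omega) (m + 2) (by positivity) (by positivity)
      simpa [IsRoot.def, eval_finsetSum] using this
    have := congrArg (fun q => coeff q i) hq
    have hi : i < n + 1 := by omega
    simpa [finsetSum_coeff, coeff_C_mul, coeff_X_pow, hi] using this

theorem eq_of_isGammaTriangle {n : ℕ} {π : Equiv.Perm (Fin n)} {γ γ' : ℕ → ℕ → ℤ}
    (h : (TypeA.clusterComplex π).IsGammaTriangle (TypeA.negSimpleRoots n) γ)
    (h' : (TypeA.clusterComplex π).IsGammaTriangle (TypeA.negSimpleRoots n) γ') : γ = γ' := by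
  rw [FinComplex.IsGammaTriangle, TypeA.card_negSimpleRoots] at h h'
  funext i j
  refine sub_eq_zero.1 (eq_zero_of_sum_eq_zero (n := n) (δ := fun i j => γ i j - γ' i j) ?_ ?_ i j)
  · intro i j hij
    rw [h.1 i j hij, h'.1 i j hij, sub_zero]
  · have := h.2.symm.trans h'.2
    rw [← sub_eq_zero, ← mul_sub, ← Finset.sum_sub_distrib] at this
    rw [← this]
    congr 1
    refine Finset.sum_congr rfl fun i _ => ?_
    rw [← Finset.sum_sub_distrib]
    refine Finset.sum_congr rfl fun j _ => ?_
    push_cast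
    ring

theorem gammaCoeff_eq {n k l : ℕ} (hk : 1 ≤ k) (hkl : l + 2 * k ≤ n) : (gammaCoeff n k l : ℚ) =
    ((l : ℚ) + 1) / ((n : ℚ) - (k : ℚ) + 1) * (n.choose k : ℚ) *
      ((n - k - l - 1).choose (k - 1) : ℚ) := by
  obtain ⟨k, rfl⟩ : ∃ j, k = j + 1 := ⟨k - 1, by omega⟩
  obtain ⟨s, rfl⟩ : ∃ s, n = l + 2 * (k + 1) + s := ⟨n - (l + 2 * (k + 1)), by omega⟩
  rw [gammaCoeff, if_pos (by omega), show l + 2 * (k + 1) + s - l = s + 2 * k + 2 by omega,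
    coeff_powCoeff, show l + 1 + s + 2 * k + 1 = l + 2 * (k + 1) + s by ring,
    show l + 2 * (k + 1) + s - (k + 1) - l - 1 = s + k by omega, Nat.add_sub_cancel]
  -- The two forms of the answer differ by trading n.choose (k-1)/k for n.choose k/(n-k+1), written
  -- here with k+1 in place of k.
  have h := Nat.choose_succ_right_eq (l + 2 * (k + 1) + s) k
  rw [show l + 2 * (k + 1) + s - k = l + s + k + 2 by omega] at h
  have h' : ((l + 2 * (k + 1) + s).choose (k + 1) : ℚ) * (k + 1) =
      (l + 2 * (k + 1) + s).choose k * (l + s + k + 2) := by exact_mod_cast h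
  have hden : ((l + 2 * (k + 1) + s : ℕ) : ℚ) - ((k + 1 : ℕ) : ℚ) + 1 = l + s + k + 2 := by
    push_cast; ring
  have h0 : ((l : ℚ) + s + k + 2) ≠ 0 := by positivity
  rw [hden]
  generalize ((l + 2 * (k + 1) + s).choose (k + 1) : ℚ) = B at *
  generalize ((l + 2 * (k + 1) + s).choose k : ℚ) = B' at *
  push_cast
  field_simp
  linear_combination -((s + k).choose k : ℚ) * h'

end GammaTriangle

end

theorem mainTheorem2 (n : ℕ) (π : Equiv.Perm (Fin n)) :
    (∃! γ : ℕ → ℕ → ℤ,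
      (TypeA.clusterComplex π).IsGammaTriangle (TypeA.negSimpleRoots n) γ) ∧
    ∀ γ : ℕ → ℕ → ℤ,
      (TypeA.clusterComplex π).IsGammaTriangle (TypeA.negSimpleRoots n) γ →
      (∀ k ℓ : ℕ, 1 ≤ k → ℓ + 2 * k ≤ n →
        (γ k ℓ : ℚ) = ((ℓ : ℚ) + 1) / ((n : ℚ) - (k : ℚ) + 1) * (n.choose k : ℚ) *
          ((n - k - ℓ - 1).choose (k - 1) : ℚ)) ∧
      γ 0 n = 1 ∧
      (∀ ℓ : ℕ, ℓ < n → γ 0 ℓ = 0) := by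
  have hγ := GammaTriangle.isGammaTriangle_gammaCoeff π
  refine ⟨⟨_, hγ, fun γ h => GammaTriangle.eq_of_isGammaTriangle h hγ⟩, fun γ h => ?_⟩
  rw [GammaTriangle.eq_of_isGammaTriangle h hγ]
  refine ⟨fun k l hk hkl => GammaTriangle.gammaCoeff_eq hk hkl, ?_, fun l hl => ?_⟩
  · simp [GammaTriangle.gammaCoeff, GammaTriangle.powCoeff_zero_right]
  · rw [GammaTriangle.gammaCoeff, if_pos hl.le,
      show n - l = n - l - 1 + 1 by omega, GammaTriangle.coeff_zero_powCoeff_succ]
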